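/- Let $d,L,m\ge 1$. For an activation $\sigma:\mathbb R\to\mathbb R$ and a constant $c>0$ consider the fully connected network with $L$ hidden layers of width $m$, input $x\in\mathbb R^d$ and scalar output, $$\alpha^{(0)}(x)=x,\qquad \alpha^{(l)}(x)=\tfrac{c}{\sqrt m}\,\sigma\big(W^{(l)}\alpha^{(l-1)}(x)\big)\ (1\le l\le L),\qquad f(x)=W^{(L+1)}\alpha^{(L)}(x),$$ where $\sigma$ acts entrywise, $W^{(1)}\in\mathbb R^{m\times d}$, $W^{(l)}\in\mathbb R^{m\times m}$ for $2\le l\le L$, $W^{(L+1)}\in\mathbb R^{1\times m}$. The ReLU network has $\sigma(t)=\max\{0,t\}$ and $c=\sqrt2$; the linear network has $\sigma(t)=t$ and $c=1$. At initialization all entries of all $W^{(l)}$ are i.i.d. $\mathcal N(0,1)$. The model gradient $\nabla f(x)$ is the gradient of $f(x)$ with respect to all parameters. For nonzero $x,z\in\mathbb R^d$ let $\theta_{in}=\theta_{in}(x,z)\in[0,\pi]$ be the angle between $x$ and $z$. The model gradient angle of the infinitely wide network at initialization is the deterministic limit in probability, as $m\to\infty$, of the angle between $\nabla f(x)$ and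 $\nabla f(z)$. For all $d,L\ge1$ and all nonzero $x,z\in\mathbb R^d$, the model gradient angle $\phi_L=\phi_L(x,z)\in[0,\pi]$ of the infinitely wide ReLU network with $L$ hidden layers exists, and there are functions $r_L:\mathbb R\to\mathbb R$ ($L\ge 1$), not depending on $d,x,z$, such that the following hold. 1. Whenever $\theta_{in}<\pi/2$, $$\cos\phi_L=\Big(1-\frac{L}{2\pi}\theta_{in}+r_L(\theta_{in})\Big)\cos\theta_{in}.$$ For each fixed $L$, $r_L(\theta)=o(\theta)$ as $\theta\to0^+$. Moreover, in the joint regime $\theta=o(1/L)$, $r_L(\theta)=o(L\theta)$ uniformly in $L$: for every $\varepsilon>0$ there is $\delta>0$ such that $|r_L(\theta)|\le\varepsilon L\theta$ for all $L\ge1$ and $\theta\ge0$ with $L\theta<\delta$. 2. For all $d,L\ge 1$ and all nonzero $x,z\in\mathbb R^d$, the model gradient angle of the infinitely wide linear network with $L$ hidden layers exists and equals $\theta_{in}$. 3. There is an absolute constant $c_0>0$ such that for all $d,L\ge 1$ and nonzero $x,z\in\mathbb R^d$ with $\theta_{in}>0$: if $L\theta_{in}<c_0$, then $\phi_L>\theta_{in}$;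 and if $1\le L_1<L_2$ and $L_2\theta_{in}<c_0$, then $\phi_{L_1}<\phi_{L_2}$. -/

import Mathlib

open Real Set Filter Topology MeasureTheory ProbabilityTheory Asymptotics InnerProductGeometry

noncomputable section

namespace WideNet

/-- Width of layer `l`: the input layer has `d` units, every hidden layer has `m` units. -/
def layerWidth (d m : ℕ) : ℕ → ℕ
  | 0 => d
  | _ + 1 => m

/-- Index set of all scalar parameters of a fully connected network with input dimension `d`,
`L` hidden layers of width `m` and one output unit. The entry `Sum.inl ⟨l, i, j⟩` is the weight
from unit `j` of layer `l` to unit `i` of layer `l + 1` (for `l = 0, …, L - 1`); the entry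
`Sum.inr j` is the weight from unit `j` of layer `L` to the output. -/
abbrev ParamIdx (d m L : ℕ) : Type :=
  (Σ l : Fin L, Fin (layerWidth d m (l + 1)) × Fin (layerWidth d m l)) ⊕ Fin (layerWidth d m L)

/-- The space of all parameters, flattened to one Euclidean vector. -/
abbrev Params (d m L : ℕ) : Type := EuclideanSpace ℝ (ParamIdx d m L)

/-- The embedding of the input `x` at layer `l`, for activation `σ` and scaling constant `c`:
`α⁽⁰⁾ = x` and `α⁽ˡ⁺¹⁾ = (c / √m) σ(W⁽ˡ⁺¹⁾ α⁽ˡ⁾)` for `l < L`.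
(Layers beyond `L` do not exist; they get the value `0`, which is never used.) -/
def embedding {d m L : ℕ} (σ : ℝ → ℝ) (c : ℝ) (w : Params d m L)
    (x : EuclideanSpace ℝ (Fin d)) : (l : ℕ) → EuclideanSpace ℝ (Fin (layerWidth d m l))
  | 0 => x
  | l + 1 => WithLp.toLp 2 fun i =>
      if h : l < L then
        c / √(m : ℝ) * σ (∑ j, w (Sum.inl ⟨⟨l, h⟩, i, j⟩) * embedding σ c w x l j)
      else 0

/-- The network output `f(w; x) = W⁽ᴸ⁺¹⁾ α⁽ᴸ⁾(x)`. -/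
def network {d m L : ℕ} (σ : ℝ → ℝ) (c : ℝ) (w : Params d m L)
    (x : EuclideanSpace ℝ (Fin d)) : ℝ :=
  ∑ j, w (Sum.inr j) * embedding σ c w x L j

/-- The model gradient: the gradient of `f(w; x)` with respect to all parameters `w`. -/
def modelGradient {d m L : ℕ} (σ : ℝ → ℝ) (c : ℝ) (w : Params d m L)
    (x : EuclideanSpace ℝ (Fin d)) : Params d m L :=
  gradient (fun v : Params d m L => network σ c v x) w

/-- The model gradient angle at width `m` and parameters `w`. -/
def modelGradientAngle {d m L : ℕ} (σ : ℝ → ℝ) (c : ℝ) (w : Params d m L)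
    (x z : EuclideanSpace ℝ (Fin d)) : ℝ :=
  angle (modelGradient σ c w x) (modelGradient σ c w z)

/-- The random initialization: all parameters are i.i.d. standard normal. -/
def initLaw (d m L : ℕ) : Measure (Params d m L) :=
  (Measure.pi fun _ : ParamIdx d m L => gaussianReal 0 1).map (WithLp.toLp 2)

/-- `φ` is the model gradient angle of the infinitely wide network at initialization: the random
model gradient angle at width `m` converges to the number `φ` in probability as `m → ∞`. -/
def IsInfiniteWidthAngle {d : ℕ} (σ : ℝ → ℝ) (c : ℝ) (L : ℕ)
    (x z : EuclideanSpace ℝ (Fin d)) (φ : ℝ) : Prop :=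
  ∀ ε : ℝ, 0 < ε →
    Tendsto (fun m : ℕ => initLaw d m L {w | ε ≤ |modelGradientAngle σ c w x z - φ|})
      atTop (𝓝 0)

/-- The ReLU network: activation `t ↦ max 0 t`, scaling `√2 / √m`. -/
def IsReLUAngle {d : ℕ} (L : ℕ) (x z : EuclideanSpace ℝ (Fin d)) (φ : ℝ) : Prop :=
  IsInfiniteWidthAngle (fun t => max 0 t) (√2) L x z φ

/-- The linear network: identity activation, scaling `1 / √m`. -/
def IsLinearAngle {d : ℕ} (L : ℕ) (x z : EuclideanSpace ℝ (Fin d)) (φ : ℝ) : Prop :=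
  IsInfiniteWidthAngle (fun t => t) 1 L x z φ

end WideNet

end

/-!
Conditionally on the previous layer, the units of a layer are independent, so by the law of large
numbers the inner product of the embeddings of two inputs converges, layer by layer, to an iterate
of the kernel `κ₁` given by the Gaussian covariances of the activation. The inner product of the two
model gradients is a Gaussian quadratic form in the output weights, whose matrix is the Gram matrix
of the gradients of the units of the last hidden layer. The Frobenius norms of these Gram matrices
tend to zero, so each such form concentrates at its trace, and the traces follow the recursion
`Θ_{l+1} = κ₁^[l+1] + Θ_l · κ₀ (κ₁^[l])` of the neural tangent kernel, where `κ₀` is the kernel of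
the derivative of the activation. For the linear network `κ₁ t = t` and `κ₀ = 1`, so
`Θ_L = (L + 1) cos θ` and the angle is that of the inputs.

For ReLU these are the arc-cosine kernels of degrees one and zero: `κ₁` decreases an angle `θ` by at
most `θ²`, while `κ₀ (cos θ) = 1 - θ / π` damps `Θ` to first order. Hence
`Θ_L / (L + 1) = 1 - L θ / (2 π) + O((L θ)²)`, and these normalized kernels are strictly decreasing
in `L` as long as `L θ` is small.
-/

noncomputable section

namespace WideNet

/-! ### Arc-cosine kernels -/

/-- The law of a vector of i.i.d. standard normal coordinates, on plain functions `ι → ℝ`: this is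
the law of one row of weights, and also of all the parameters of a network at once. -/
abbrev stdGaussianPi (ι : Type*) [Fintype ι] : Measure (ι → ℝ) :=
  Measure.pi fun _ => gaussianReal 0 1

section GaussianPair

variable {E F : Type*} [NormedAddCommGroup E] [InnerProductSpace ℝ E]
  [NormedAddCommGroup F] [InnerProductSpace ℝ F]

lemma comp_innerSL_prod_innerSL (M : StrongDual ℝ (ℝ × ℝ)) (u v : E) :
    M.comp ((innerSL ℝ u).prod (innerSL ℝ v)) = innerSL ℝ (M (1, 0) • u + M (0, 1) • v) := by
  ext w
  have decompose : ((inner ℝ u w, inner ℝ v w) : ℝ × ℝ) =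
      (inner ℝ u w : ℝ) • ((1, 0) : ℝ × ℝ) + (inner ℝ v w : ℝ) • ((0, 1) : ℝ × ℝ) := by simp
  rw [innerSL_apply_apply, inner_add_left, real_inner_smul_left, real_inner_smul_left,
    ContinuousLinearMap.comp_apply, ContinuousLinearMap.prod_apply, innerSL_apply_apply,
    innerSL_apply_apply, decompose, map_add, map_smul, map_smul, smul_eq_mul, smul_eq_mul]
  ring

lemma norm_smul_add_smul_congr {a b : E} {a' b' : F} (ha : ‖a‖ = ‖a'‖) (hb : ‖b‖ = ‖b'‖)
    (hab : inner ℝ a b = inner ℝ a' b') (s t : ℝ) : ‖s • a + t • b‖ = ‖s • a' + t • b'‖ := by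
  rw [← sq_eq_sq₀ (norm_nonneg _) (norm_nonneg _), @norm_add_sq_real, @norm_add_sq_real]
  simp only [norm_smul, real_inner_smul_left, real_inner_smul_right, ha, hb, hab]

variable [FiniteDimensional ℝ E] [MeasurableSpace E] [BorelSpace E]
  [FiniteDimensional ℝ F] [MeasurableSpace F] [BorelSpace F]

lemma map_stdGaussian_eq_of_norm_comp_eq {G : Type*} [NormedAddCommGroup G] [NormedSpace ℝ G]
    [CompleteSpace G] [SecondCountableTopology G] [MeasurableSpace G] [BorelSpace G]
    (S : E →L[ℝ] G) (T : F →L[ℝ] G) (h : ∀ M : StrongDual ℝ G, ‖M.comp S‖ = ‖M.comp T‖) :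
    (stdGaussian E).map S = (stdGaussian F).map T := by
  refine Measure.ext_of_charFunDual (funext fun M => ?_)
  rw [charFunDual_map, charFunDual_map, charFunDual_stdGaussian, charFunDual_stdGaussian, h]

lemma map_stdGaussian_inner_pair_congr {a b : E} {a' b' : F} (ha : ‖a‖ = ‖a'‖) (hb : ‖b‖ = ‖b'‖)
    (hab : inner ℝ a b = inner ℝ a' b') :
    (stdGaussian E).map (fun w => ((inner ℝ a w, inner ℝ b w) : ℝ × ℝ)) =
      (stdGaussian F).map (fun w => (inner ℝ a' w, inner ℝ b' w)) :=
  map_stdGaussian_eq_of_norm_comp_eq ((innerSL ℝ a).prod (innerSL ℝ b))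
    ((innerSL ℝ a').prod (innerSL ℝ b')) fun M => by
      rw [comp_innerSL_prod_innerSL, comp_innerSL_prod_innerSL, innerSL_apply_norm,
        innerSL_apply_norm, norm_smul_add_smul_congr ha hb hab]

lemma map_stdGaussianPi_inner_pair {ι : Type*} [Fintype ι] (a b : EuclideanSpace ℝ ι) :
    (stdGaussianPi ι).map (fun v => (∑ j, v j * a j, ∑ j, v j * b j)) =
      (stdGaussian (EuclideanSpace ℝ ι)).map (fun w => (inner ℝ a w, inner ℝ b w)) := by
  rw [← map_pi_eq_stdGaussian, Measure.map_map (by fun_prop) (by fun_prop)]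
  rfl

lemma map_stdGaussianPi_pair {ι : Type*} [Fintype ι] (a b : EuclideanSpace ℝ ι) :
    (stdGaussianPi ι).map (fun v => (∑ j, v j * a j, ∑ j, v j * b j)) =
      ((gaussianReal 0 1).prod (gaussianReal 0 1)).map
        (fun p => (‖a‖ * p.1, ‖b‖ * (cos (angle a b) * p.1 + sin (angle a b) * p.2))) := by
  set θ := angle a b
  let a' : EuclideanSpace ℝ (Fin 2) := !₂[‖a‖, 0]
  let b' : EuclideanSpace ℝ (Fin 2) := !₂[‖b‖ * cos θ, ‖b‖ * sin θ]
  have norm_a' : ‖a‖ = ‖a'‖ := by simp [a', EuclideanSpace.norm_eq, sqrt_sq]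
  have norm_b' : ‖b‖ = ‖b'‖ := by
    simp [b', EuclideanSpace.norm_eq, mul_pow, ← mul_add, sqrt_sq]
  have inner_a'_b' : inner ℝ a b = inner ℝ a' b' := by
    rw [← cos_angle_mul_norm_mul_norm a b]
    simp [a', b', θ, PiLp.inner_apply, Fin.sum_univ_two]
    ring
  rw [map_stdGaussianPi_inner_pair, map_stdGaussian_inner_pair_congr norm_a' norm_b' inner_a'_b',
    ← map_stdGaussianPi_inner_pair, ← (measurePreserving_finTwoArrow (gaussianReal 0 1)).map_eq,
    Measure.map_map (by fun_prop) (MeasurableEquiv.measurable _)]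
  congr 1
  ext v <;> simp [a', b', Fin.sum_univ_two, MeasurableEquiv.finTwoArrow] <;> ring

lemma stdGaussianPi_sum_mul_eq_zero {ι : Type*} [Fintype ι] {a : EuclideanSpace ℝ ι}
    (ha : a ≠ 0) : stdGaussianPi ι {v | ∑ j, v j * a j = 0} = 0 := by
  have axis_meas : MeasurableSet {p : ℝ × ℝ | p.1 = 0} :=
    measurable_fst (measurableSet_singleton 0)
  have axis_preimage : (fun p : ℝ × ℝ =>
      (‖a‖ * p.1, ‖a‖ * (cos (angle a a) * p.1 + sin (angle a a) * p.2))) ⁻¹'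
        {p | p.1 = 0} = {(0 : ℝ)} ×ˢ univ := by
    ext p
    simp [ha]
  have := nullSingletonClass_gaussianReal (μ := 0) (v := 1) one_ne_zero
  have h := congrArg (fun μ => μ {p : ℝ × ℝ | p.1 = 0}) (map_stdGaussianPi_pair a a)
  rwa [Measure.map_apply (by fun_prop) axis_meas, Measure.map_apply (by fun_prop) axis_meas,
    axis_preimage, Measure.prod_prod, measure_singleton, zero_mul] at h

end GaussianPair

section Polar

lemma gaussianPDFReal_mul_polar (r t : ℝ) :
    gaussianPDFReal 0 1 (r * cos t) * gaussianPDFReal 0 1 (r * sin t) =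
      (2 * π)⁻¹ * exp (-(1 / 2) * r ^ (2 : ℝ)) := by
  simp only [gaussianPDFReal, NNReal.coe_one, mul_one, sub_zero]
  rw [mul_mul_mul_comm, ← exp_add, ← mul_inv, Real.mul_self_sqrt (by positivity)]
  congr 2
  rw [rpow_two]
  linear_combination (-(r ^ 2) / 2) * (sin_sq_add_cos_sq t)

lemma integral_pow_mul_exp_neg_sq_div_two (k : ℕ) :
    ∫ r in Ioi (0 : ℝ), r ^ (2 * k + 1) * exp (-(1 / 2) * r ^ (2 : ℝ)) = 2 ^ k * k.factorial := by
  have h := integral_rpow_mul_exp_neg_mul_rpow (p := 2) (q := (2 * k + 1 : ℕ)) (b := 1 / 2)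
    (by norm_num) (by linarith [(Nat.cast_nonneg (2 * k + 1) : (0 : ℝ) ≤ (2 * k + 1 : ℕ))])
    (by norm_num)
  simp only [rpow_natCast] at h
  have exponent : ((2 * k + 1 : ℕ) + 1 : ℝ) / 2 = k + 1 := by push_cast; ring
  rw [h, neg_div, exponent, Gamma_nat_eq_factorial, rpow_neg (by norm_num),
    ← inv_rpow (by norm_num), one_div, inv_inv, rpow_add_one two_ne_zero, rpow_natCast]
  ring

lemma gaussianReal_prod_eq_withDensity :
    (gaussianReal 0 1).prod (gaussianReal 0 1) = (volume : Measure (ℝ × ℝ)).withDensity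
      (fun p => gaussianPDF 0 1 p.1 * gaussianPDF 0 1 p.2) := by
  rw [gaussianReal_of_var_ne_zero 0 one_ne_zero,
    prod_withDensity (measurable_gaussianPDF 0 1) (measurable_gaussianPDF 0 1),
    Measure.volume_eq_prod]

lemma integral_gaussianReal_prod_of_homogeneous {f : ℝ × ℝ → ℝ} {h : ℝ → ℝ} (k : ℕ)
    (hf : ∀ r t : ℝ, 0 < r → f (r * cos t, r * sin t) = r ^ (2 * k) * h t) :
    ∫ p, f p ∂((gaussianReal 0 1).prod (gaussianReal 0 1)) =
      2 ^ k * k.factorial / (2 * π) * ∫ t in Ioo (-π) π, h t := by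
  have density_meas : Measurable fun p : ℝ × ℝ => gaussianPDF 0 1 p.1 * gaussianPDF 0 1 p.2 := by
    fun_prop
  rw [gaussianReal_prod_eq_withDensity, integral_withDensity_eq_integral_toReal_smul density_meas
    (ae_of_all _ fun _ => ENNReal.mul_lt_top gaussianPDF_lt_top gaussianPDF_lt_top),
    ← integral_comp_polarCoord_symm]
  have separate : ∀ p ∈ polarCoord.target, p.1 • (((gaussianPDF 0 1 (polarCoord.symm p).1 *
      gaussianPDF 0 1 (polarCoord.symm p).2).toReal) • f (polarCoord.symm p)) =
      (2 * π)⁻¹ * ((p.1 ^ (2 * k + 1) * exp (-(1 / 2) * p.1 ^ (2 : ℝ))) * h p.2) := by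
    rintro ⟨r, t⟩ ⟨hr, -⟩
    simp only [polarCoord_symm_apply, ENNReal.toReal_mul, toReal_gaussianPDF, smul_eq_mul,
      gaussianPDFReal_mul_polar, hf r t hr]
    ring
  rw [setIntegral_congr_fun polarCoord.open_target.measurableSet separate, integral_const_mul,
    polarCoord_target, Measure.volume_eq_prod,
    setIntegral_prod_mul (fun r : ℝ => r ^ (2 * k + 1) * exp (-(1 / 2) * r ^ (2 : ℝ))) h,
    integral_pow_mul_exp_neg_sq_div_two]
  ring

lemma cos_pos_and_cos_sub_pos_iff {θ t : ℝ} (hθ₀ : 0 ≤ θ) (hθπ : θ ≤ π) (ht : t ∈ Ioo (-π) π) :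
    (0 < cos t ∧ 0 < cos (t - θ)) ↔ t ∈ Ioo (θ - π / 2) (π / 2) := by
  obtain ⟨ht₁, ht₂⟩ := ht
  refine ⟨fun ⟨cos_t, cos_sub⟩ => ⟨?_, ?_⟩, fun ⟨h₁, h₂⟩ =>
    ⟨cos_pos_of_mem_Ioo ⟨by linarith, h₂⟩, cos_pos_of_mem_Ioo ⟨by linarith, by linarith⟩⟩⟩
  · have neg_half_pi_lt : -(π / 2) < t := by
      by_contra! h
      rw [← cos_neg] at cos_t
      exact absurd cos_t (cos_nonpos_of_pi_div_two_le_of_le (by linarith) (by linarith)).not_gt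
    by_contra! h
    rw [← cos_neg, neg_sub] at cos_sub
    exact absurd cos_sub (cos_nonpos_of_pi_div_two_le_of_le (by linarith) (by linarith)).not_gt
  · by_contra! h
    exact absurd cos_t (cos_nonpos_of_pi_div_two_le_of_le h (by linarith)).not_gt

lemma setIntegral_mul_comp_cos {ψ : ℝ → ℝ} (hψ : ∀ t ≤ 0, ψ t = 0) {θ : ℝ} (hθ₀ : 0 ≤ θ)
    (hθπ : θ ≤ π) :
    ∫ t in Ioo (-π) π, ψ (cos t) * ψ (cos (t - θ)) =
      ∫ t in Ioo (θ - π / 2) (π / 2), ψ (cos t) * ψ (cos (t - θ)) := by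
  have subset : Ioo (θ - π / 2) (π / 2) ⊆ Ioo (-π) π :=
    Ioo_subset_Ioo (by linarith [pi_pos]) (by linarith [pi_pos])
  refine setIntegral_eq_of_subset_of_forall_sdiff_eq_zero measurableSet_Ioo subset ?_
  rintro t ⟨ht, ht'⟩
  rw [← cos_pos_and_cos_sub_pos_iff hθ₀ hθπ ht, not_and_or, not_lt, not_lt] at ht'
  rcases ht' with h | h <;> simp [hψ _ h]

lemma integral_cos_mul_cos_sub (θ : ℝ) :
    ∫ t in (θ - π / 2)..(π / 2), cos t * cos (t - θ) = (sin θ + (π - θ) * cos θ) / 2 := by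
  have cos_add_part (t : ℝ) : cos (2 * t - θ) = cos t * cos (t - θ) - sin t * sin (t - θ) := by
    rw [← cos_add]; congr 1; ring
  have cos_sub_part (t : ℝ) : cos θ = cos t * cos (t - θ) + sin t * sin (t - θ) := by
    rw [← cos_sub]; congr 1; ring
  have antideriv (t : ℝ) (_ : t ∈ uIcc (θ - π / 2) (π / 2)) :
      HasDerivAt (fun t => (sin (2 * t - θ) / 2 + t * cos θ) / 2) (cos t * cos (t - θ)) t := by
    have inner_deriv : HasDerivAt (fun t : ℝ => 2 * t - θ) 2 t := by
      simpa using ((hasDerivAt_id t).const_mul 2).sub_const θ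
    convert! (((inner_deriv.sin).div_const 2).add
      ((hasDerivAt_id t).mul_const (cos θ))).div_const 2 using 1
    rw [cos_add_part]
    linear_combination (-1 / 2) * cos_sub_part t
  rw [intervalIntegral.integral_eq_sub_of_hasDerivAt antideriv
    (Continuous.intervalIntegrable (by fun_prop) _ _),
    show 2 * (π / 2) - θ = π - θ by ring, sin_pi_sub,
    show 2 * (θ - π / 2) - θ = θ - π by ring, sin_sub_pi]
  ring

end Polar

/-- The covariance `𝔼[ψ(⟨v, a⟩) ψ(⟨v, b⟩)]` of a standard Gaussian vector `v`: the dual activation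
of `ψ`. For the activation of the network and its derivative, these are the kernels through which
the infinitely wide network propagates inner products. -/
def gaussianCov (ψ : ℝ → ℝ) {ι : Type*} [Fintype ι] (a b : ι → ℝ) : ℝ :=
  ∫ v, ψ (∑ j, v j * a j) * ψ (∑ j, v j * b j) ∂(stdGaussianPi ι)

/-- The normalized arc-cosine kernel of degree one, as a function of the cosine of the angle. -/
def arccosKernelOne (ρ : ℝ) : ℝ := (√(1 - ρ ^ 2) + (π - arccos ρ) * ρ) / π

/-- The normalized arc-cosine kernel of degree zero, as a function of the cosine of the angle. -/
def arccosKernelZero (ρ : ℝ) : ℝ := 1 - arccos ρ / π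

lemma arccosKernelOne_cos {θ : ℝ} (h₀ : 0 ≤ θ) (hπ : θ ≤ π) :
    arccosKernelOne (cos θ) = (sin θ + (π - θ) * cos θ) / π := by
  rw [arccosKernelOne, arccos_cos h₀ hπ, ← sin_sq, sqrt_sq (sin_nonneg_of_nonneg_of_le_pi h₀ hπ)]

lemma arccosKernelZero_cos {θ : ℝ} (h₀ : 0 ≤ θ) (hπ : θ ≤ π) :
    arccosKernelZero (cos θ) = 1 - θ / π := by
  rw [arccosKernelZero, arccos_cos h₀ hπ]

section GaussianCov

variable {ι : Type*} [Fintype ι]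

lemma gaussianCov_eq_integral_prod {ψ : ℝ → ℝ} (hψ : Measurable ψ) (a b : EuclideanSpace ℝ ι) :
    gaussianCov ψ a b = ∫ p, ψ (‖a‖ * p.1) *
        ψ (‖b‖ * (cos (angle a b) * p.1 + sin (angle a b) * p.2))
      ∂((gaussianReal 0 1).prod (gaussianReal 0 1)) := by
  have hψψ : Measurable fun q : ℝ × ℝ => ψ q.1 * ψ q.2 := by fun_prop
  have map_pair := integral_map (μ := stdGaussianPi ι)
    (φ := fun v => (∑ j, v j * a j, ∑ j, v j * b j)) (by fun_prop) hψψ.aestronglyMeasurable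
  rw [map_stdGaussianPi_pair, integral_map (by fun_prop) hψψ.aestronglyMeasurable] at map_pair
  exact map_pair.symm

lemma gaussianCov_of_homogeneous {ψ : ℝ → ℝ} (hψ : Measurable ψ) {k : ℕ}
    (hk : ∀ s t, 0 < s → ψ (s * t) = s ^ k * ψ t) {a b : EuclideanSpace ℝ ι}
    (ha : a ≠ 0) (hb : b ≠ 0) :
    gaussianCov ψ a b = 2 ^ k * k.factorial / (2 * π) * ((‖a‖ * ‖b‖) ^ k *
      ∫ t in Ioo (-π) π, ψ (cos t) * ψ (cos (t - angle a b))) := by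
  rw [gaussianCov_eq_integral_prod hψ, ← integral_const_mul]
  refine integral_gaussianReal_prod_of_homogeneous k fun r t hr => ?_
  have polar_sub : cos (angle a b) * (r * cos t) + sin (angle a b) * (r * sin t) =
      r * cos (t - angle a b) := by rw [cos_sub]; ring
  simp only [polar_sub, hk _ _ (norm_pos_iff.2 ha), hk _ _ (norm_pos_iff.2 hb), hk _ _ hr]
  ring

lemma gaussianCov_relu {a b : EuclideanSpace ℝ ι} (ha : a ≠ 0) (hb : b ≠ 0) :
    gaussianCov (fun t => max 0 t) a b =
      ‖a‖ * ‖b‖ * arccosKernelOne (cos (angle a b)) / 2 := by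
  have hθ₀ := angle_nonneg a b
  have hθπ := angle_le_pi a b
  have homogeneous (s t : ℝ) (hs : 0 < s) : max 0 (s * t) = s ^ 1 * max 0 t := by
    rw [pow_one, mul_max_of_nonneg _ _ hs.le, mul_zero]
  rw [gaussianCov_of_homogeneous (by fun_prop) homogeneous ha hb,
    setIntegral_mul_comp_cos (ψ := fun t => max 0 t) (fun t ht => max_eq_left ht) hθ₀ hθπ,
    arccosKernelOne_cos hθ₀ hθπ, setIntegral_congr_fun (g := fun t => cos t * cos (t - angle a b))
      measurableSet_Ioo, ← integral_Ioc_eq_integral_Ioo,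
    ← intervalIntegral.integral_of_le (by linarith), integral_cos_mul_cos_sub]
  · simp
    field_simp
  · intro t ht
    obtain ⟨h₁, h₂⟩ := (cos_pos_and_cos_sub_pos_iff hθ₀ hθπ
      ⟨by linarith [ht.1, pi_pos], by linarith [ht.2, pi_pos]⟩).2 ht
    simp only [max_eq_right h₁.le, max_eq_right h₂.le]

lemma gaussianCov_step {a b : EuclideanSpace ℝ ι} (ha : a ≠ 0) (hb : b ≠ 0) :
    gaussianCov (fun t => if 0 < t then 1 else 0) a b = arccosKernelZero (cos (angle a b)) / 2 := by
  have hθ₀ := angle_nonneg a b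
  have hθπ := angle_le_pi a b
  have homogeneous (s t : ℝ) (hs : 0 < s) :
      (if 0 < s * t then (1 : ℝ) else 0) = s ^ 0 * if 0 < t then 1 else 0 := by
    simp [mul_pos_iff_of_pos_left hs]
  rw [gaussianCov_of_homogeneous (measurable_const.ite measurableSet_Ioi measurable_const)
      homogeneous ha hb,
    setIntegral_mul_comp_cos (ψ := fun t => if 0 < t then 1 else 0)
      (fun t ht => if_neg ht.not_gt) hθ₀ hθπ, arccosKernelZero_cos hθ₀ hθπ,
    setIntegral_congr_fun (g := fun _ => 1) measurableSet_Ioo]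
  · simp [show 0 ≤ π / 2 - (angle a b - π / 2) by linarith]
    field_simp
    ring
  · intro t ht
    obtain ⟨h₁, h₂⟩ := (cos_pos_and_cos_sub_pos_iff hθ₀ hθπ
      ⟨by linarith [ht.1, pi_pos], by linarith [ht.2, pi_pos]⟩).2 ht
    simp only [if_pos h₁, if_pos h₂, mul_one]

end GaussianCov

/-! ### Convergence in probability and conditioning -/

/-- The filter of events of asymptotically full probability in a sequence of measure spaces.
Convergence in probability is convergence along this filter. -/
def whp {Ω : ℕ → Type*} [∀ m, MeasurableSpace (Ω m)] (μ : ∀ m, Measure (Ω m)) :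
    Filter (Σ m, Ω m) where
  sets := {S | Tendsto (fun m => μ m {w | (⟨m, w⟩ : Σ m, Ω m) ∉ S}) atTop (𝓝 0)}
  univ_sets := by simp
  sets_of_superset hS hST :=
    tendsto_of_tendsto_of_tendsto_of_le_of_le tendsto_const_nhds hS (fun _ => zero_le)
      fun _ => measure_mono fun _ hw h => hw (hST h)
  inter_sets {S T} hS hT := by
    have hadd := Tendsto.add hS hT
    rw [add_zero] at hadd
    refine tendsto_of_tendsto_of_tendsto_of_le_of_le tendsto_const_nhds hadd
      (fun _ => zero_le) fun m => (measure_mono fun _ hw => ?_).trans (measure_union_le _ _)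
    exact not_and_or.1 hw

section Whp

variable {Ω Ω' : ℕ → Type*} [∀ m, MeasurableSpace (Ω m)] [∀ m, MeasurableSpace (Ω' m)]
  {μ : ∀ m, Measure (Ω m)} {μ' : ∀ m, Measure (Ω' m)}

lemma eventually_whp {p : (Σ m, Ω m) → Prop} :
    (∀ᶠ x in whp μ, p x) ↔ Tendsto (fun m => μ m {w : Ω m | ¬ p ⟨m, w⟩}) atTop (𝓝 0) := Iff.rfl

lemma tendsto_fst_whp : Tendsto Sigma.fst (whp μ) atTop := fun S hS => by
  change Tendsto (fun m => μ m {_w | m ∉ S}) atTop (𝓝 0)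
  refine tendsto_const_nhds.congr' ?_
  filter_upwards [hS] with m hm
  simp [hm]

lemma prod_apply_le_add {α β : Type*} [MeasurableSpace α] [MeasurableSpace β] (μ : Measure α)
    (ν : Measure β) [IsProbabilityMeasure μ] [IsProbabilityMeasure ν] {E : Set (α × β)}
    (hE : MeasurableSet E) (η : ENNReal) :
    μ.prod ν E ≤ η + μ {x | ¬ ν (Prod.mk x ⁻¹' E) ≤ η} := by
  set bad := {x | ¬ ν (Prod.mk x ⁻¹' E) ≤ η}
  have hbad : MeasurableSet bad :=
    (measurableSet_le (measurable_measure_prodMk_left hE) measurable_const).compl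
  calc μ.prod ν E = ∫⁻ x, ν (Prod.mk x ⁻¹' E) ∂μ := Measure.prod_apply hE
    _ ≤ ∫⁻ x, (η + bad.indicator 1 x) ∂μ := by
        refine lintegral_mono fun x => ?_
        by_cases hx : x ∈ bad
        · rw [indicator_of_mem hx]
          exact prob_le_one.trans le_add_self
        · exact (not_not.1 hx).trans le_self_add
    _ = η + μ bad := by
        rw [lintegral_add_left measurable_const, lintegral_indicator_one hbad]
        simp

variable [∀ m, IsProbabilityMeasure (μ m)] [∀ m, IsProbabilityMeasure (μ' m)]
  {T : ∀ m, Ω m × Ω' m → Ω m}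

lemma eventually_whp_notMem_of_resample
    (hT : ∀ m, MeasurePreserving (T m) ((μ m).prod (μ' m)) (μ m)) {E : ∀ m, Set (Ω m)}
    (hE : ∀ m, MeasurableSet (E m))
    (h : Tendsto (fun x : Σ m, Ω m => μ' x.1 {v | T x.1 (x.2, v) ∈ E x.1}) (whp μ) (𝓝 0)) :
    ∀ᶠ x in whp μ, x.2 ∉ E x.1 := by
  simp only [eventually_whp, not_not]
  refine ENNReal.tendsto_nhds_zero.2 fun η hη => ?_
  have hη2 : 0 < η / 2 := ENNReal.half_pos hη.ne'
  have hbad : ∀ᶠ m in atTop,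
      μ m {w | ¬ μ' m (Prod.mk w ⁻¹' (T m ⁻¹' E m)) ≤ η / 2} ≤ η / 2 :=
    ENNReal.tendsto_nhds_zero.1 (eventually_whp.1 (ENNReal.tendsto_nhds_zero.1 h _ hη2)) _ hη2
  filter_upwards [hbad] with m hm
  calc μ m (E m) = (μ m).prod (μ' m) (T m ⁻¹' E m) :=
        ((hT m).measure_preimage (hE m).nullMeasurableSet).symm
    _ ≤ η / 2 + η / 2 := (prod_apply_le_add _ _ ((hT m).measurable (hE m)) _).trans (by gcongr)
    _ = η := ENNReal.add_halves η

lemma tendsto_whp_zero_of_resample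
    (hT : ∀ m, MeasurePreserving (T m) ((μ m).prod (μ' m)) (μ m)) {Y : ∀ m, Ω m → ℝ}
    (hY : ∀ m, Measurable (Y m)) (hY0 : ∀ m w, 0 ≤ Y m w) {B : (Σ m, Ω m) → ℝ}
    (hB : Tendsto B (whp μ) (𝓝 0))
    (h : ∀ᶠ x in whp μ, ∃ g : Ω' x.1 → ℝ, Integrable g (μ' x.1) ∧
      (∀ v, Y x.1 (T x.1 (x.2, v)) ≤ g v) ∧ ∫ v, g v ∂μ' x.1 ≤ B x) :
    Tendsto (fun x : Σ m, Ω m => Y x.1 x.2) (whp μ) (𝓝 0) := by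
  refine Metric.tendsto_nhds.2 fun ε hε => ?_
  have hlim : Tendsto (fun x => ENNReal.ofReal (B x / ε)) (whp μ) (𝓝 0) := by
    simpa [Function.comp_def] using
      (ENNReal.continuous_ofReal.tendsto _).comp (hB.div_const ε)
  have hrare := eventually_whp_notMem_of_resample (μ' := μ') hT
    (fun m => measurableSet_le (f := fun _ => ε) measurable_const (hY m))
    (tendsto_of_tendsto_of_tendsto_of_le_of_le' tendsto_const_nhds hlim
      (Eventually.of_forall fun _ => zero_le) ?_)
  · filter_upwards [hrare] with x hx
    rw [dist_zero_right, Real.norm_eq_abs, abs_of_nonneg (hY0 _ _)]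
    exact not_le.1 hx
  · filter_upwards [h] with x ⟨g, hg, hYg, hgB⟩
    have hmarkov := mul_meas_ge_le_integral_of_nonneg
      (ae_of_all _ fun v => (hY0 x.1 _).trans (hYg v)) hg ε
    refine (measure_mono (t := {v | ε ≤ g v}) fun v (hv : ε ≤ _) => hv.trans (hYg v)).trans ?_
    rw [← ENNReal.ofReal_toReal (measure_ne_top (μ' x.1) {v | ε ≤ g v})]
    refine ENNReal.ofReal_le_ofReal ?_
    rw [le_div_iff₀ hε, mul_comm]
    exact hmarkov.trans hgB

lemma tendsto_whp_zero_of_resample_sq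
    (hT : ∀ m, MeasurePreserving (T m) ((μ m).prod (μ' m)) (μ m)) {Y : ∀ m, Ω m → ℝ}
    (hY : ∀ m, Measurable (Y m)) {B : (Σ m, Ω m) → ℝ} (hB : Tendsto B (whp μ) (𝓝 0))
    (h : ∀ᶠ x in whp μ, ∃ g : Ω' x.1 → ℝ, Integrable g (μ' x.1) ∧
      (∀ v, Y x.1 (T x.1 (x.2, v)) ^ 2 ≤ g v) ∧ ∫ v, g v ∂μ' x.1 ≤ B x) :
    Tendsto (fun x : Σ m, Ω m => Y x.1 x.2) (whp μ) (𝓝 0) := by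
  have hsq := tendsto_whp_zero_of_resample hT (fun m => (hY m).pow_const 2)
    (fun _ _ => sq_nonneg _) hB h
  rw [tendsto_zero_iff_abs_tendsto_zero]
  simpa [sqrt_sq_eq_abs, Function.comp_def] using (continuous_sqrt.tendsto _).comp hsq

end Whp

section ProductMeasure

variable {ι β κ X : Type*}

lemma preimage_extend_univ_pi {e : β → ι} (he : Function.Injective e) (s : ι → Set X) :
    (fun p : (ι → X) × (β → X) => Function.extend e p.2 p.1) ⁻¹' univ.pi s =
      (((range e)ᶜ).pi s) ×ˢ univ.pi fun b => s (e b) := by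
  ext p
  rw [mem_preimage, mem_prod, mem_univ_pi, mem_univ_pi]
  constructor
  · refine fun h => ⟨fun i (hi : ¬ ∃ b, e b = i) => ?_, fun b => ?_⟩
    · simpa only [Function.extend_apply' _ _ _ hi] using h i
    · simpa only [he.extend_apply] using h (e b)
  · rintro ⟨hout, hin⟩ i
    by_cases hi : ∃ b, e b = i
    · obtain ⟨b, rfl⟩ := hi
      simpa only [he.extend_apply] using hin b
    · simpa only [Function.extend_apply' _ _ _ hi] using hout i hi

variable [MeasurableSpace X]

lemma measurable_extend {e : β → ι} (he : Function.Injective e) :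
    Measurable fun p : (ι → X) × (β → X) => Function.extend e p.2 p.1 := by
  refine measurable_pi_lambda _ fun i => ?_
  by_cases hi : ∃ b, e b = i
  · obtain ⟨b, rfl⟩ := hi
    simp only [he.extend_apply]
    fun_prop
  · simp only [Function.extend_apply' _ _ _ hi]
    fun_prop

variable [Fintype ι] [Fintype β] [Fintype κ]

lemma measurePreserving_extend (ν : ι → Measure X) [∀ i, IsProbabilityMeasure (ν i)]
    {e : β → ι} (he : Function.Injective e) :
    MeasurePreserving (fun p : (ι → X) × (β → X) => Function.extend e p.2 p.1)
      ((Measure.pi ν).prod (Measure.pi fun b => ν (e b))) (Measure.pi ν) := by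
  classical
  refine ⟨measurable_extend he, (Measure.pi_eq fun s hs => ?_).symm⟩
  have hbox : ((range e)ᶜ).pi s = univ.pi fun i => if i ∈ range e then univ else s i := by
    ext w
    refine forall_congr' fun i => ?_
    by_cases hi : i ∈ range e <;> simp [hi]
  have hrange : ∏ b, ν (e b) (s (e b)) = ∏ i with i ∈ range e, ν i (s i) := by
    rw [← Finset.prod_image (f := fun i => ν i (s i)) fun _ _ _ _ h => he h]
    congr 1
    ext i
    simp
  rw [Measure.map_apply (measurable_extend he) (MeasurableSet.univ_pi hs),
    preimage_extend_univ_pi he, Measure.prod_prod, hbox, Measure.pi_pi, Measure.pi_pi, hrange,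
    Finset.prod_filter, ← Finset.prod_mul_distrib]
  refine Finset.prod_congr rfl fun i _ => ?_
  by_cases hi : i ∈ range e <;> simp [hi]

lemma measurePreserving_uncurry (ν : κ → β → Measure X) [∀ k b, IsProbabilityMeasure (ν k b)] :
    MeasurePreserving (fun (V : κ → β → X) (p : κ × β) => V p.1 p.2)
      (Measure.pi fun k => Measure.pi (ν k)) (Measure.pi fun p : κ × β => ν p.1 p.2) := by
  have hmap := Measure.infinitePi_map_curry_symm ν
  simp only [Measure.infinitePi_eq_pi] at hmap
  exact ⟨by fun_prop, hmap⟩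

variable {ν : Measure X} [IsProbabilityMeasure ν] {f : X → ℝ}

lemma memLp_sum_comp_eval_sub (hf : MemLp f 2 ν) (M : ℝ) :
    MemLp (fun V : κ → X => ∑ i, (f (V i) - M)) 2 (Measure.pi fun _ => ν) :=
  memLp_finsetSum _ fun i _ => (hf.sub (memLp_const M)).comp_measurePreserving
    (measurePreserving_eval (fun _ : κ => ν) i)

lemma integral_sum_sub_integral_sq_le (hf : MemLp f 2 ν) :
    ∫ V : κ → X, (∑ i, (f (V i) - ∫ u, f u ∂ν)) ^ 2 ∂Measure.pi (fun _ => ν) ≤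
      Fintype.card κ * ∫ u, f u ^ 2 ∂ν := by
  set M := ∫ u, f u ∂ν
  have hmean : ∫ V : κ → X, ∑ i, (f (V i) - M) ∂Measure.pi (fun _ => ν) = 0 := by
    have hint (i : κ) : Integrable (fun V : κ → X => f (V i) - M) (Measure.pi fun _ => ν) :=
      integrable_comp_eval (μ := fun _ : κ => ν) (f := fun u => f u - M)
        ((hf.sub (memLp_const M)).integrable one_le_two)
    rw [integral_finsetSum _ fun i _ => hint i]
    refine Finset.sum_eq_zero fun i _ => ?_
    rw [integral_comp_eval (μ := fun _ : κ => ν) (f := fun u => f u - M)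
      (hf.sub (memLp_const M)).aestronglyMeasurable, integral_sub
      (hf.integrable one_le_two) (integrable_const M)]
    simp [M]
  have hvar := variance_sum_pi (μ := fun _ : κ => ν) (X := fun _ u => f u - M)
    fun _ => hf.sub (memLp_const M)
  simp only [Finset.sum_fn] at hvar
  rw [variance_of_integral_eq_zero (memLp_sum_comp_eval_sub hf M).aemeasurable hmean] at hvar
  simp only [hvar, variance_sub_const hf.aestronglyMeasurable, Finset.sum_const,
    Finset.card_univ, nsmul_eq_mul]
  gcongr
  exact variance_le_expectation_sq hf.aestronglyMeasurable

end ProductMeasure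

/-! ### Gaussian quadratic forms -/

section Moments

lemma integrable_pow_gaussianReal (n : ℕ) : Integrable (fun t => t ^ n) (gaussianReal 0 1) :=
  (memLp_id_gaussianReal n).integrable_norm_pow'.mono (by fun_prop) (ae_of_all _ fun t => by simp)

lemma memLp_pow_gaussianReal (n : ℕ) : MemLp (fun t => t ^ n) 2 (gaussianReal 0 1) := by
  refine (memLp_two_iff_integrable_sq (by fun_prop)).2 ?_
  simpa only [← pow_mul] using integrable_pow_gaussianReal (n * 2)

lemma integral_sq_gaussianReal : ∫ t, t ^ 2 ∂gaussianReal 0 1 = 1 := by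
  have hvar := variance_fun_id_gaussianReal (μ := 0) (v := 1)
  rw [variance_eq_integral (by fun_prop)] at hvar
  simpa using hvar

lemma integral_pow_four_gaussianReal : ∫ t, t ^ 4 ∂gaussianReal 0 1 = 3 := by
  have hcos : ∫ t in Ioo (-π) π, cos t ^ 4 = 3 / 4 * π := by
    rw [← integral_Ioc_eq_integral_Ioo, ← intervalIntegral.integral_of_le (by linarith [pi_pos]),
      integral_cos_pow, integral_cos_sq]
    simp
    ring
  have hpolar := integral_gaussianReal_prod_of_homogeneous (f := fun p => p.1 ^ 4)
    (h := fun t => cos t ^ 4) 2 fun r t _ => by ring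
  rw [hcos, integral_fun_fst (fun t => t ^ 4)] at hpolar
  simp only [probReal_univ, one_smul] at hpolar
  rw [hpolar]
  field_simp
  norm_num

lemma variance_sq_gaussianReal : Var[fun t => t ^ 2; gaussianReal 0 1] = 2 := by
  rw [variance_eq_sub (memLp_pow_gaussianReal 2)]
  simp only [Pi.pow_apply, ← pow_mul, integral_sq_gaussianReal]
  rw [integral_pow_four_gaussianReal]
  norm_num

end Moments

lemma measurable_sum_mul_sq {ι : Type*} [Fintype ι] (c : ι → ℝ) :
    Measurable fun g : ι → ℝ => ∑ i, c i * g i ^ 2 := by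
  fun_prop

section Spectral

variable {E : Type*} [NormedAddCommGroup E] [InnerProductSpace ℝ E] [FiniteDimensional ℝ E]
  {T : E →ₗ[ℝ] E} (hT : T.IsSymmetric)
include hT

lemma inner_sum_smul_eigenvectorBasis (g : Fin (Module.finrank ℝ E) → ℝ) :
    inner ℝ (∑ i, g i • hT.eigenvectorBasis rfl i) (T (∑ i, g i • hT.eigenvectorBasis rfl i)) =
      ∑ i, hT.eigenvalues rfl i * g i ^ 2 := by
  simp only [map_sum, map_smul, hT.apply_eigenvectorBasis, smul_smul,
    (hT.eigenvectorBasis rfl).orthonormal.inner_sum]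
  refine Finset.sum_congr rfl fun i _ => ?_
  simp only [RCLike.ofReal_real_eq_id, id, conj_trivial]
  ring

lemma trace_comp_self_eq_sum_sq_eigenvalues :
    LinearMap.trace ℝ E (T ∘ₗ T) = ∑ i, hT.eigenvalues rfl i ^ 2 := by
  rw [LinearMap.trace_eq_sum_inner _ (hT.eigenvectorBasis rfl)]
  refine Finset.sum_congr rfl fun i _ => ?_
  simp [hT.apply_eigenvectorBasis, real_inner_smul_right, sq]

end Spectral

section StdGaussian

variable {E : Type*} [NormedAddCommGroup E] [InnerProductSpace ℝ E] [FiniteDimensional ℝ E]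
  [MeasurableSpace E] [BorelSpace E]

variable {T : E →ₗ[ℝ] E} (hT : T.IsSymmetric)
include hT

/- In an eigenbasis the quadratic form is a weighted sum of squares of i.i.d. standard normals. -/
lemma map_inner_apply_self_stdGaussian :
    (stdGaussian E).map (fun v => inner ℝ v (T v)) =
      (stdGaussianPi (Fin (Module.finrank ℝ E))).map
        fun g => ∑ i, hT.eigenvalues rfl i * g i ^ 2 := by
  have hTcont : Continuous T := T.continuous_of_finiteDimensional
  rw [stdGaussian_eq_map_pi_orthonormalBasis (hT.eigenvectorBasis rfl),
    Measure.map_map (by fun_prop) (by fun_prop)]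
  congr 1
  ext g
  exact inner_sum_smul_eigenvectorBasis hT g

lemma memLp_inner_apply_self_stdGaussian :
    MemLp (fun v => inner ℝ v (T v)) 2 (stdGaussian E) := by
  have hTcont : Continuous T := T.continuous_of_finiteDimensional
  have hmap : MemLp id 2 ((stdGaussian E).map fun v => inner ℝ v (T v)) := by
    rw [map_inner_apply_self_stdGaussian hT]
    refine (memLp_map_measure_iff (by fun_prop) (measurable_sum_mul_sq _).aemeasurable).2 ?_
    exact memLp_finsetSum (ι := Fin _) Finset.univ fun i _ =>
      ((memLp_pow_gaussianReal 2).comp_measurePreserving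
        (measurePreserving_eval (fun _ => gaussianReal 0 1) i)).const_mul (hT.eigenvalues rfl i)
  exact (memLp_map_measure_iff (by fun_prop) (by fun_prop)).1 hmap

lemma integral_inner_apply_self_stdGaussian :
    ∫ v, inner ℝ v (T v) ∂stdGaussian E = LinearMap.trace ℝ E T := by
  have hTcont : Continuous T := T.continuous_of_finiteDimensional
  have hint (i : Fin (Module.finrank ℝ E)) : Integrable (fun g : Fin (Module.finrank ℝ E) → ℝ =>
      hT.eigenvalues rfl i * g i ^ 2) (stdGaussianPi _) :=
    (integrable_comp_eval (μ := fun _ => gaussianReal 0 1) (i := i) (f := fun t : ℝ => t ^ 2)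
      (integrable_pow_gaussianReal 2)).const_mul _
  rw [hT.trace_eq_sum_eigenvalues rfl, ← integral_map (μ := stdGaussian E)
    (φ := fun v => inner ℝ v (T v)) (f := fun t => t) (by fun_prop) (by fun_prop),
    map_inner_apply_self_stdGaussian hT, integral_map (measurable_sum_mul_sq _).aemeasurable
    (by fun_prop), integral_finsetSum _ fun i _ => hint i]
  refine Finset.sum_congr rfl fun i _ => ?_
  rw [integral_const_mul, integral_comp_eval (μ := fun _ => gaussianReal 0 1)
    (f := fun t : ℝ => t ^ 2) (by fun_prop), integral_sq_gaussianReal, mul_one]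

lemma variance_inner_apply_self_stdGaussian :
    Var[fun v => inner ℝ v (T v); stdGaussian E] = 2 * LinearMap.trace ℝ E (T ∘ₗ T) := by
  have hTcont : Continuous T := T.continuous_of_finiteDimensional
  rw [← variance_id_map (by fun_prop), map_inner_apply_self_stdGaussian hT,
    variance_id_map (measurable_sum_mul_sq _).aemeasurable]
  have hsum := variance_sum_pi (μ := fun _ : Fin (Module.finrank ℝ E) => gaussianReal 0 1)
    (X := fun i t => hT.eigenvalues rfl i * t ^ 2)
    fun i => (memLp_pow_gaussianReal 2).const_mul _
  simp only [Finset.sum_fn] at hsum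
  rw [hsum, trace_comp_self_eq_sum_sq_eigenvalues hT, Finset.mul_sum]
  refine Finset.sum_congr rfl fun i _ => ?_
  rw [variance_const_mul, variance_sq_gaussianReal, mul_comm]

end StdGaussian

section Matrix

open Matrix Kronecker

variable {α κ : Type*} [Fintype α] [Fintype κ]

lemma measurePreserving_toLp_stdGaussianPi :
    MeasurePreserving (WithLp.toLp 2) (stdGaussianPi α) (stdGaussian (EuclideanSpace ℝ α)) :=
  ⟨by fun_prop, map_pi_eq_stdGaussian⟩

lemma symmetrization_dotProduct_mulVec (A : Matrix α α ℝ) (v : α → ℝ) :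
    v ⬝ᵥ (((1 / 2 : ℝ) • (A + Aᵀ)) *ᵥ v) = v ⬝ᵥ A *ᵥ v := by
  rw [smul_mulVec, add_mulVec, dotProduct_smul, dotProduct_add, dotProduct_transpose_mulVec]
  rw [smul_eq_mul]
  ring

lemma trace_symmetrization_mul_self_le (A : Matrix α α ℝ) :
    (((1 / 2 : ℝ) • (A + Aᵀ)) * ((1 / 2 : ℝ) • (A + Aᵀ))).trace ≤ ∑ a, ∑ b, A a b ^ 2 := by
  have hswap : ∑ a, ∑ b, A b a ^ 2 = ∑ a, ∑ b, A a b ^ 2 := Finset.sum_comm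
  calc (((1 / 2 : ℝ) • (A + Aᵀ)) * ((1 / 2 : ℝ) • (A + Aᵀ))).trace
      ≤ ∑ a, ∑ b, (A a b ^ 2 / 2 + A b a ^ 2 / 2) := by
        simp only [trace, diag_apply, mul_apply, Matrix.smul_apply, Matrix.add_apply,
          transpose_apply, smul_eq_mul]
        gcongr with a _ b _
        nlinarith [sq_nonneg (A a b - A b a)]
    _ = ∑ a, ∑ b, A a b ^ 2 := by
        simp only [Finset.sum_add_distrib, ← Finset.sum_div, hswap]
        ring

lemma isSymmetric_toEuclideanLin_symmetrization [DecidableEq α] (A : Matrix α α ℝ) :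
    (toEuclideanLin ((1 / 2 : ℝ) • (A + Aᵀ))).IsSymmetric := by
  refine isSymmetric_toEuclideanLin_iff.2 ?_
  simp [IsHermitian, conjTranspose_eq_transpose_of_trivial, add_comm]

lemma dotProduct_mulVec_eq_inner [DecidableEq α] (A : Matrix α α ℝ)
    (v : α → ℝ) :
    v ⬝ᵥ A *ᵥ v = inner ℝ (WithLp.toLp 2 v) (toEuclideanLin A (WithLp.toLp 2 v)) := by
  rw [EuclideanSpace.inner_eq_star_dotProduct, star_trivial, dotProduct_comm]
  rfl

lemma trace_toEuclideanLin [DecidableEq α] (A : Matrix α α ℝ) :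
    LinearMap.trace ℝ _ (toEuclideanLin A) = A.trace :=
  trace_toLin_eq A (PiLp.basisFun 2 ℝ α)

lemma memLp_dotProduct_mulVec_self (A : Matrix α α ℝ) :
    MemLp (fun v => v ⬝ᵥ A *ᵥ v) 2 (stdGaussianPi α) := by
  classical
  simp only [← symmetrization_dotProduct_mulVec A, dotProduct_mulVec_eq_inner]
  exact (memLp_inner_apply_self_stdGaussian
    (isSymmetric_toEuclideanLin_symmetrization A)).comp_measurePreserving
      measurePreserving_toLp_stdGaussianPi

lemma integral_dotProduct_mulVec_self (A : Matrix α α ℝ) :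
    ∫ v, v ⬝ᵥ A *ᵥ v ∂stdGaussianPi α = A.trace := by
  classical
  simp only [← symmetrization_dotProduct_mulVec A, dotProduct_mulVec_eq_inner]
  rw [measurePreserving_toLp_stdGaussianPi.integral_comp
    (MeasurableEquiv.toLp 2 _).measurableEmbedding
    (fun u => inner ℝ u (toEuclideanLin ((1 / 2 : ℝ) • (A + Aᵀ)) u)),
    integral_inner_apply_self_stdGaussian (isSymmetric_toEuclideanLin_symmetrization A),
    trace_toEuclideanLin, trace_smul, trace_add, trace_transpose, smul_eq_mul]
  ring

lemma integral_dotProduct_mulVec_self_sub_trace_sq_le (A : Matrix α α ℝ) :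
    ∫ v, (v ⬝ᵥ A *ᵥ v - A.trace) ^ 2 ∂stdGaussianPi α ≤ 2 * ∑ a, ∑ b, A a b ^ 2 := by
  classical
  rw [← integral_dotProduct_mulVec_self A,
    ← variance_eq_integral (memLp_dotProduct_mulVec_self A).aemeasurable]
  simp only [← symmetrization_dotProduct_mulVec A, dotProduct_mulVec_eq_inner]
  rw [measurePreserving_toLp_stdGaussianPi.variance_fun_comp
    (f := fun u => inner ℝ u (toEuclideanLin ((1 / 2 : ℝ) • (A + Aᵀ)) u))
    (memLp_inner_apply_self_stdGaussian
      (isSymmetric_toEuclideanLin_symmetrization A)).aemeasurable,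
    variance_inner_apply_self_stdGaussian (isSymmetric_toEuclideanLin_symmetrization A),
    ← toLpLin_mul_same, trace_toEuclideanLin]
  gcongr
  exact trace_symmetrization_mul_self_le A

lemma integral_dotProduct_mulVec_self_sq_le (A : Matrix α α ℝ) :
    ∫ v, (v ⬝ᵥ A *ᵥ v) ^ 2 ∂stdGaussianPi α ≤ A.trace ^ 2 + 2 * ∑ a, ∑ b, A a b ^ 2 := by
  have hvar := variance_eq_sub (memLp_dotProduct_mulVec_self A)
  rw [variance_eq_integral (memLp_dotProduct_mulVec_self A).aemeasurable,
    integral_dotProduct_mulVec_self] at hvar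
  have hsub := integral_dotProduct_mulVec_self_sub_trace_sq_le A
  simp only [Pi.pow_apply] at hvar
  linarith

lemma sum_mul_mul_sum_mul_eq_dotProduct_mulVec (a b v : α → ℝ) :
    (∑ j, v j * a j) * (∑ j, v j * b j) = v ⬝ᵥ vecMulVec a b *ᵥ v := by
  rw [vecMulVec_mulVec, dotProduct_smul, dotProduct_comm b v]
  rfl

lemma integrable_sum_mul_sq_mul_sum_mul_sq (a b : α → ℝ) :
    Integrable (fun v : α → ℝ => ((∑ j, v j * a j) * (∑ j, v j * b j)) ^ 2) (stdGaussianPi α) := by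
  simp only [sum_mul_mul_sum_mul_eq_dotProduct_mulVec]
  exact (memLp_dotProduct_mulVec_self _).integrable_sq

lemma integral_sum_mul_sq_mul_sum_mul_sq_le (a b : EuclideanSpace ℝ α) :
    ∫ v : α → ℝ, ((∑ j, v j * a j) * (∑ j, v j * b j)) ^ 2 ∂stdGaussianPi α ≤
      3 * (‖a‖ * ‖b‖) ^ 2 := by
  simp only [sum_mul_mul_sum_mul_eq_dotProduct_mulVec]
  refine (integral_dotProduct_mulVec_self_sq_le _).trans ?_
  have htrace : (vecMulVec a b).trace ^ 2 ≤ (‖a‖ * ‖b‖) ^ 2 := by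
    rw [trace_vecMulVec, dotProduct_comm]
    exact sq_le_sq' (neg_le_of_abs_le (abs_real_inner_le_norm a b)) (real_inner_le_norm a b)
  have hfrob : ∑ i, ∑ j, vecMulVec a b i j ^ 2 = (‖a‖ * ‖b‖) ^ 2 := by
    simp only [vecMulVec_apply, mul_pow, ← Finset.mul_sum, ← Finset.sum_mul,
      EuclideanSpace.real_norm_sq_eq]
  linarith

/- The bilinear form in two rows of `V` is a quadratic form in all of `V`. -/
lemma dotProduct_mulVec_eq_single_kronecker [DecidableEq κ] (A : Matrix α α ℝ) (i k : κ)
    (V : κ → α → ℝ) :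
    V i ⬝ᵥ A *ᵥ V k =
      (fun p : κ × α => V p.1 p.2) ⬝ᵥ (single i k 1 ⊗ₖ A) *ᵥ fun p : κ × α => V p.1 p.2 := by
  simp [dotProduct, mulVec, Fintype.sum_prod_type, single_apply, ite_and, Finset.sum_ite_eq]

lemma integrable_row_dotProduct_mulVec_row_sq (A : Matrix α α ℝ) (i k : κ) :
    Integrable (fun V : κ → α → ℝ => (V i ⬝ᵥ A *ᵥ V k) ^ 2)
      (Measure.pi fun _ => stdGaussianPi α) := by
  classical
  simp only [dotProduct_mulVec_eq_single_kronecker A i k]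
  exact ((memLp_dotProduct_mulVec_self (single i k 1 ⊗ₖ A)).comp_measurePreserving
    (measurePreserving_uncurry fun (_ : κ) (_ : α) => gaussianReal 0 1)).integrable_sq

lemma integral_row_dotProduct_mulVec_row_sq_le [DecidableEq κ] (A : Matrix α α ℝ) (i k : κ) :
    ∫ V : κ → α → ℝ, (V i ⬝ᵥ A *ᵥ V k) ^ 2 ∂Measure.pi (fun _ => stdGaussianPi α) ≤
      (if i = k then A.trace ^ 2 else 0) + 2 * ∑ a, ∑ b, A a b ^ 2 := by
  have hpres : MeasurePreserving (fun (V : κ → α → ℝ) (p : κ × α) => V p.1 p.2)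
      (Measure.pi fun _ => stdGaussianPi α) (stdGaussianPi (κ × α)) :=
    measurePreserving_uncurry fun _ _ => gaussianReal 0 1
  have hmeas := (memLp_dotProduct_mulVec_self (single i k 1 ⊗ₖ A)).aestronglyMeasurable.pow 2
  have htrace : (single i k 1 ⊗ₖ A).trace ^ 2 = if i = k then A.trace ^ 2 else 0 := by
    rw [trace_kronecker]
    split_ifs with h <;> simp [h, trace_single_eq_of_ne]
  have hfrob : ∑ p, ∑ q, (single i k 1 ⊗ₖ A) p q ^ 2 = ∑ a, ∑ b, A a b ^ 2 := by
    simp [Fintype.sum_prod_type, single_apply, ite_and]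
  have hcomp : ∫ V : κ → α → ℝ, (V i ⬝ᵥ A *ᵥ V k) ^ 2 ∂Measure.pi (fun _ => stdGaussianPi α) =
      ∫ u, (u ⬝ᵥ (single i k 1 ⊗ₖ A) *ᵥ u) ^ 2 ∂stdGaussianPi (κ × α) := by
    simp only [dotProduct_mulVec_eq_single_kronecker A i k]
    rw [← hpres.map_eq]
    exact (integral_map hpres.aemeasurable (by rwa [hpres.map_eq])).symm
  rw [hcomp, ← htrace, ← hfrob]
  exact integral_dotProduct_mulVec_self_sq_le _

end Matrix

/-! ### Gradients of finite networks -/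

section Network

open Matrix

variable {d m L : ℕ}

/-- The position of the weights from layer `l` to layer `l + 1` among all parameters. -/
def weightIdx {l : ℕ} (h : l < L) (p : Fin m × Fin (layerWidth d m l)) : ParamIdx d m L :=
  Sum.inl ⟨⟨l, h⟩, p⟩

lemma weightIdx_injective {l : ℕ} (h : l < L) :
    Function.Injective (weightIdx (d := d) (m := m) h) :=
  fun _ _ hpq => sigma_mk_injective (β := fun l : Fin L =>
    Fin (layerWidth d m (l + 1)) × Fin (layerWidth d m l)) (Sum.inl.inj hpq)

lemma weightIdx_notMem_range_weightIdx {l l' : ℕ} (h : l < L) (h' : l' < L) (hne : l ≠ l')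
    (p : Fin m × Fin (layerWidth d m l)) : weightIdx h p ∉ range (weightIdx h') := by
  rintro ⟨q, hq⟩
  exact hne (congrArg (fun r : Σ l : Fin L, Fin (layerWidth d m (l + 1)) ×
    Fin (layerWidth d m l) => (r.1 : ℕ)) (Sum.inl.inj hq)).symm

lemma inr_notMem_range_weightIdx {l : ℕ} (h : l < L) (j : Fin (layerWidth d m L)) :
    Sum.inr j ∉ range (weightIdx (d := d) (m := m) h) := by
  simp [weightIdx]

/-- The weight matrix `W⁽ˡ⁺¹⁾`. -/
def weights (w : Params d m L) {l : ℕ} (h : l < L) : Matrix (Fin m) (Fin (layerWidth d m l)) ℝ :=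
  of fun i j => w (weightIdx h (i, j))

variable (σ : ℝ → ℝ) (c : ℝ) (w : Params d m L) (x z : EuclideanSpace ℝ (Fin d))

/-- The input of unit `i` of layer `l + 1` before the activation. -/
def preactivation {l : ℕ} (h : l < L) (i : Fin m) : ℝ :=
  ∑ j, weights w h i j * embedding σ c w x l j

lemma embedding_succ {l : ℕ} (h : l < L) (i : Fin (layerWidth d m (l + 1))) :
    embedding σ c w x (l + 1) i = c / √(m : ℝ) * σ (preactivation σ c w x h i) := by
  simp only [embedding, h, dif_pos]
  rfl

lemma hasFDerivAt_apply (p : ParamIdx d m L) :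
    HasFDerivAt (fun v : Params d m L => v p) (innerSL ℝ (EuclideanSpace.single p (1 : ℝ))) w := by
  convert! (EuclideanSpace.proj (𝕜 := ℝ) p).hasFDerivAt (x := w) using 1
  ext v
  simp [innerSL_apply_apply, EuclideanSpace.inner_single_left]

variable {w} in
lemma hasFDerivAt_sum_mul {ι : Type*} [Fintype ι] {f : Params d m L → ι → ℝ}
    {g : ι → Params d m L} (p : ι → ParamIdx d m L)
    (hf : ∀ j, HasFDerivAt (fun v => f v j) (innerSL ℝ (g j)) w) :
    HasFDerivAt (fun v : Params d m L => ∑ j, v (p j) * f v j)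
      (innerSL ℝ (∑ j, (w (p j) • g j + f w j • EuclideanSpace.single (p j) (1 : ℝ)))) w := by
  have hsum := HasFDerivAt.fun_sum (u := Finset.univ) fun j _ =>
    (hasFDerivAt_apply w (p j)).mul (hf j)
  convert! hsum using 1
  simp [map_sum, map_add, map_smul]

/-- The gradient of unit `i` of layer `l` with respect to all parameters, computed by the chain
rule; this is correct when the activation is differentiable at all preactivations. -/
def embeddingGrad : (l : ℕ) → Fin (layerWidth d m l) → Params d m L
  | 0, _ => 0
  | l + 1, i =>
      if h : l < L then
        (c / √(m : ℝ) * deriv σ (preactivation σ c w x h i)) •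
          ∑ j, (weights w h i j • embeddingGrad l j +
            embedding σ c w x l j • EuclideanSpace.single (weightIdx (m := m) h (i, j)) (1 : ℝ))
      else 0

/-- The gradient of the output with respect to all parameters, computed by the chain rule. -/
def networkGrad : Params d m L :=
  ∑ j, (w (Sum.inr j) • embeddingGrad σ c w x L j +
    embedding σ c w x L j • EuclideanSpace.single (Sum.inr j) (1 : ℝ))

lemma embeddingGrad_succ {l : ℕ} (h : l < L) (i : Fin (layerWidth d m (l + 1))) :
    embeddingGrad σ c w x (l + 1) i = (c / √(m : ℝ) * deriv σ (preactivation σ c w x h i)) •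
      ∑ j, (weights w h i j • embeddingGrad σ c w x l j +
        embedding σ c w x l j • EuclideanSpace.single (weightIdx (m := m) h (i, j)) (1 : ℝ)) := by
  simp only [embeddingGrad, h, dif_pos]

section Derivative

variable {σ c w x} (hσ : ∀ t, t ≠ 0 → DifferentiableAt ℝ σ t)
  (hw : ∀ l (h : l < L) i, preactivation σ c w x h i ≠ 0)
include hσ hw

lemma hasFDerivAt_embedding (l : ℕ) (hl : l ≤ L) (i : Fin (layerWidth d m l)) :
    HasFDerivAt (fun v : Params d m L => embedding σ c v x l i)
      (innerSL ℝ (embeddingGrad σ c w x l i)) w := by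
  induction l with
  | zero =>
    simp only [embedding, embeddingGrad, map_zero]
    exact hasFDerivAt_const _ _
  | succ l ih =>
    have h : l < L := hl
    have hpre := hasFDerivAt_sum_mul (fun j => weightIdx h (i, j)) fun j => ih h.le j
    have hact := ((hσ _ (hw l h i)).hasDerivAt.comp_hasFDerivAt w hpre).const_mul (c / √(m : ℝ))
    rw [embeddingGrad_succ σ c w x h i, map_smul, mul_smul]
    exact hact.congr_of_eventuallyEq (.of_forall fun v => embedding_succ σ c v x h i)

lemma modelGradient_eq_networkGrad : modelGradient σ c w x = networkGrad σ c w x := by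
  refine HasGradientAt.gradient (hasGradientAt_iff_hasFDerivAt.2 ?_)
  exact hasFDerivAt_sum_mul Sum.inr fun j => hasFDerivAt_embedding hσ hw L le_rfl j

end Derivative

section Gram

/-- The Gram matrix of the gradients of the units of layer `l` at two inputs. -/
def gradGram (l : ℕ) : Matrix (Fin (layerWidth d m l)) (Fin (layerWidth d m l)) ℝ :=
  of fun i k => inner ℝ (embeddingGrad σ c w x l i) (embeddingGrad σ c w z l k)

/-- The Gram entry of the embeddings of two inputs at layer `l`. -/
def embeddingGram (l : ℕ) : ℝ :=
  inner ℝ (embedding σ c w x l) (embedding σ c w z l)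

lemma embeddingGram_eq_sum (l : ℕ) :
    embeddingGram σ c w x z l = ∑ j, embedding σ c w x l j * embedding σ c w z l j := by
  simp [embeddingGram, PiLp.inner_apply, mul_comm]

lemma embeddingGrad_apply_eq_zero {l : ℕ} {p : ParamIdx d m L}
    (hp : ∀ l' (h : l' < L), l' < l → p ∉ range (weightIdx h)) (i : Fin (layerWidth d m l)) :
    embeddingGrad σ c w x l i p = 0 := by
  induction l with
  | zero => simp [embeddingGrad]
  | succ l ih =>
    by_cases h : l < L
    · have hprev := ih fun l' h' hl => hp l' h' (by omega)
      have hne (q) : p ≠ weightIdx h q := fun hpq => hp l h l.lt_succ_self ⟨q, hpq.symm⟩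
      simp [embeddingGrad_succ σ c w x h i, hprev, hne]
    · simp [embeddingGrad, h]

variable {σ c w x z} in
lemma inner_sum_smul_add_smul_single {ι ι' : Type*} [Fintype ι] [Fintype ι']
    {g : ι → Params d m L} {g' : ι' → Params d m L} {p : ι → ParamIdx d m L}
    {q : ι' → ParamIdx d m L} (hg : ∀ a b, g a (q b) = 0) (hg' : ∀ b a, g' b (p a) = 0)
    (u α : ι → ℝ) (v β : ι' → ℝ) :
    inner ℝ (∑ a, (u a • g a + α a • EuclideanSpace.single (p a) (1 : ℝ)))
      (∑ b, (v b • g' b + β b • EuclideanSpace.single (q b) (1 : ℝ))) =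
      u ⬝ᵥ (of fun a b => inner ℝ (g a) (g' b)) *ᵥ v +
        ∑ a, ∑ b, if p a = q b then α a * β b else 0 := by
  simp only [dotProduct, mulVec, of_apply, Finset.mul_sum]
  rw [sum_inner, ← Finset.sum_add_distrib]
  simp only [inner_sum, ← Finset.sum_add_distrib]
  refine Finset.sum_congr rfl fun a _ => Finset.sum_congr rfl fun b _ => ?_
  have hleft : inner ℝ (g a) (EuclideanSpace.single (q b) (1 : ℝ)) = 0 := by
    simp [EuclideanSpace.inner_single_right, hg a b]
  have hright : inner ℝ (EuclideanSpace.single (p a) (1 : ℝ)) (g' b) = 0 := by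
    simp [EuclideanSpace.inner_single_left, hg' b a]
  have hsingle : inner ℝ (EuclideanSpace.single (p a) (1 : ℝ)) (EuclideanSpace.single (q b) 1) =
      if p a = q b then (1 : ℝ) else 0 := by
    simp [EuclideanSpace.inner_single_left]
  simp only [inner_add_left, inner_add_right, real_inner_smul_left, real_inner_smul_right, hleft,
    hright, hsingle]
  split_ifs <;> ring

lemma gradGram_succ {l : ℕ} (h : l < L) (i k : Fin m) :
    gradGram σ c w x z (l + 1) i k =
      c ^ 2 / m *
        (deriv σ (preactivation σ c w x h i) * deriv σ (preactivation σ c w z h k)) *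
        (weights w h i ⬝ᵥ gradGram σ c w x z l *ᵥ weights w h k +
          if i = k then embeddingGram σ c w x z l else 0) := by
  have hdisj (y) (i : Fin m) (a b) : embeddingGrad σ c w y l a (weightIdx h (i, b)) = 0 :=
    embeddingGrad_apply_eq_zero σ c w y
      (fun l' h' hl => weightIdx_notMem_range_weightIdx h h' hl.ne' _) a
  have hdiag : (∑ a, ∑ b, if i = k ∧ a = b then embedding σ c w x l a * embedding σ c w z l b
      else 0) = if i = k then embeddingGram σ c w x z l else 0 := by
    by_cases hik : i = k <;> simp [hik, embeddingGram_eq_sum]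
  have hscale : c ^ 2 / m = (c / √(m : ℝ)) ^ 2 := by rw [div_pow, sq_sqrt (Nat.cast_nonneg m)]
  change inner ℝ (embeddingGrad σ c w x (l + 1) i) (embeddingGrad σ c w z (l + 1) k) = _
  rw [embeddingGrad_succ σ c w x h i, embeddingGrad_succ σ c w z h k,
    real_inner_smul_left, real_inner_smul_right,
    inner_sum_smul_add_smul_single (hdisj x k) (hdisj z i)]
  simp only [(weightIdx_injective h).eq_iff, Prod.mk.injEq, hdiag, gradGram, hscale]
  ring

lemma inner_networkGrad :
    inner ℝ (networkGrad σ c w x) (networkGrad σ c w z) =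
      (fun j => w (Sum.inr j)) ⬝ᵥ gradGram σ c w x z L *ᵥ (fun j => w (Sum.inr j)) +
        embeddingGram σ c w x z L := by
  have hdisj (y) (a b) : embeddingGrad σ c w y L a (Sum.inr b) = 0 :=
    embeddingGrad_apply_eq_zero σ c w y (fun _ h _ => inr_notMem_range_weightIdx h _) a
  rw [networkGrad, networkGrad, inner_sum_smul_add_smul_single (hdisj x) (hdisj z)]
  simp [gradGram, embeddingGram_eq_sum]

end Gram

section Locality

variable {w} {w' : Params d m L} {l : ℕ}
  (hw : ∀ l' (h : l' < L), l' < l → weights w h = weights w' h)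
include hw

lemma embedding_congr : embedding σ c w x l = embedding σ c w' x l := by
  induction l with
  | zero => rfl
  | succ l ih =>
    have hprev := ih fun l' h hl => hw l' h (by omega)
    by_cases h : l < L
    · ext i
      simp only [embedding_succ _ _ _ _ h i, preactivation, hprev, hw l h (by omega)]
    · simp [embedding, h]

lemma embeddingGrad_congr : embeddingGrad σ c w x l = embeddingGrad σ c w' x l := by
  induction l with
  | zero => rfl
  | succ l ih =>
    have hw' : ∀ l' (h : l' < L), l' < l → weights w h = weights w' h :=
      fun l' h hl => hw l' h (by omega)
    ext i : 1
    by_cases h : l < L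
    · simp only [embeddingGrad_succ _ _ _ _ h i, preactivation, ih hw', embedding_congr σ c x hw',
        hw l h (by omega)]
    · simp [embeddingGrad, h]

lemma embeddingGram_congr : embeddingGram σ c w x z l = embeddingGram σ c w' x z l := by
  simp only [embeddingGram, embedding_congr σ c _ hw]

lemma gradGram_congr : gradGram σ c w x z l = gradGram σ c w' x z l := by
  simp only [gradGram, embeddingGrad_congr σ c _ hw]

end Locality

section Measurability

variable {σ} (hσ : Measurable σ)

lemma measurable_weights {l : ℕ} (h : l < L) (i : Fin m) (j : Fin (layerWidth d m l)) :
    Measurable fun w : Params d m L => weights w h i j := by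
  simp only [weights, of_apply]
  fun_prop

include hσ

lemma measurable_embedding (l : ℕ) (i : Fin (layerWidth d m l)) :
    Measurable fun w : Params d m L => embedding σ c w x l i := by
  induction l with
  | zero =>
    simp only [embedding]
    exact measurable_const
  | succ l ih =>
    by_cases h : l < L
    · simp only [embedding_succ _ _ _ _ h i, preactivation]
      exact (hσ.comp (Finset.measurable_sum _ fun j _ =>
        (measurable_weights h i j).mul (ih j))).const_mul _
    · simp [embedding, h]

lemma measurable_preactivation {l : ℕ} (h : l < L) (i : Fin m) :
    Measurable fun w : Params d m L => preactivation σ c w x h i :=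
  Finset.measurable_sum _ fun j _ =>
    (measurable_weights h i j).mul (measurable_embedding c x hσ l j)

lemma measurable_embeddingGram (l : ℕ) :
    Measurable fun w : Params d m L => embeddingGram σ c w x z l := by
  simp only [embeddingGram_eq_sum]
  exact Finset.measurable_sum _ fun j _ =>
    (measurable_embedding c x hσ l j).mul (measurable_embedding c z hσ l j)

lemma measurable_gradGram (l : ℕ) (i k : Fin (layerWidth d m l)) :
    Measurable fun w : Params d m L => gradGram σ c w x z l i k := by
  induction l with
  | zero => simp [gradGram, embeddingGrad]
  | succ l ih =>
    by_cases h : l < L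
    · have hderiv (y) (i) : Measurable fun w : Params d m L =>
          deriv σ (preactivation σ c w y h i) :=
        (measurable_deriv σ).comp (measurable_preactivation c y hσ h i)
      rw [funext fun w : Params d m L => gradGram_succ σ c w x z h i k]
      simp only [dotProduct, mulVec]
      refine (((hderiv x i).mul (hderiv z k)).const_mul _).mul (Measurable.add ?_ ?_)
      · exact Finset.measurable_sum _ fun a _ => (measurable_weights h i a).mul <|
          Finset.measurable_sum _ fun b _ => (ih a b).mul (measurable_weights h k b)
      · exact .ite (MeasurableSet.const _) (measurable_embeddingGram c x z hσ l) measurable_const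
    · simp [gradGram, embeddingGrad, h]

end Measurability

end Network

/-! ### Resampling one layer of the random network -/

section Resampling

variable {d m L : ℕ}

instance : IsProbabilityMeasure (initLaw d m L) :=
  Measure.isProbabilityMeasure_map (by fun_prop)

/-- The parameters `w` with the coordinates indexed by the range of `e` replaced by `v`. -/
def overwrite {β : Type*} (e : β → ParamIdx d m L) (w : Params d m L) (v : β → ℝ) :
    Params d m L :=
  WithLp.toLp 2 (Function.extend e v w)

lemma measurePreserving_overwrite {β : Type*} [Fintype β] {e : β → ParamIdx d m L}
    (he : Function.Injective e) :
    MeasurePreserving (fun p : Params d m L × (β → ℝ) => overwrite e p.1 p.2)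
      ((initLaw d m L).prod (stdGaussianPi β)) (initLaw d m L) := by
  have htoLp : MeasurePreserving (MeasurableEquiv.toLp 2 (ParamIdx d m L → ℝ))
      (stdGaussianPi (ParamIdx d m L)) (initLaw d m L) :=
    ⟨(MeasurableEquiv.toLp 2 _).measurable, rfl⟩
  exact htoLp.comp ((measurePreserving_extend (fun _ => gaussianReal 0 1) he).comp
    ((htoLp.symm _).prod (.id _)))

/-- The parameters `w` with the weight matrix `W⁽ˡ⁺¹⁾` replaced by `V`. -/
def overwriteLayer {l : ℕ} (h : l < L) (w : Params d m L)
    (V : Fin m → Fin (layerWidth d m l) → ℝ) : Params d m L :=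
  overwrite (weightIdx h) w fun p => V p.1 p.2

lemma measurePreserving_overwriteLayer {l : ℕ} (h : l < L) :
    MeasurePreserving (fun p : Params d m L × (Fin m → Fin (layerWidth d m l) → ℝ) =>
        overwriteLayer h p.1 p.2)
      ((initLaw d m L).prod (Measure.pi fun _ => stdGaussianPi (Fin (layerWidth d m l))))
      (initLaw d m L) :=
  (measurePreserving_overwrite (d := d) (m := m) (weightIdx_injective h)).comp
    ((MeasurePreserving.id (initLaw d m L)).prod
      (measurePreserving_uncurry fun (_ : Fin m) (_ : Fin (layerWidth d m l)) => gaussianReal 0 1))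

variable {l : ℕ} (h : l < L) (σ : ℝ → ℝ) (c : ℝ) (w : Params d m L)
  (x z : EuclideanSpace ℝ (Fin d))

lemma weights_overwriteLayer_self (V : Fin m → Fin (layerWidth d m l) → ℝ) :
    weights (overwriteLayer h w V) h = V := by
  ext i j
  exact (weightIdx_injective h).extend_apply (fun p => V p.1 p.2) w (i, j)

lemma weights_overwriteLayer_of_lt {l' : ℕ} (h' : l' < L) (hl : l' < l)
    (V : Fin m → Fin (layerWidth d m l) → ℝ) :
    weights w h' = weights (overwriteLayer h w V) h' := by
  ext i j
  exact (Function.extend_apply' (fun p : Fin m × Fin (layerWidth d m l) => V p.1 p.2) w _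
    (weightIdx_notMem_range_weightIdx h' h hl.ne (i, j))).symm

lemma embedding_overwriteLayer (V : Fin m → Fin (layerWidth d m l) → ℝ) :
    embedding σ c (overwriteLayer h w V) x l = embedding σ c w x l :=
  (embedding_congr σ c x fun _ h' hl => weights_overwriteLayer_of_lt h w h' hl V).symm

lemma embeddingGram_overwriteLayer (V : Fin m → Fin (layerWidth d m l) → ℝ) :
    embeddingGram σ c (overwriteLayer h w V) x z l = embeddingGram σ c w x z l :=
  (embeddingGram_congr σ c x z fun _ h' hl => weights_overwriteLayer_of_lt h w h' hl V).symm

lemma gradGram_overwriteLayer (V : Fin m → Fin (layerWidth d m l) → ℝ) :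
    gradGram σ c (overwriteLayer h w V) x z l = gradGram σ c w x z l :=
  (gradGram_congr σ c x z fun _ h' hl => weights_overwriteLayer_of_lt h w h' hl V).symm

lemma preactivation_overwriteLayer (V : Fin m → Fin (layerWidth d m l) → ℝ) (i : Fin m) :
    preactivation σ c (overwriteLayer h w V) x h i = ∑ j, V i j * embedding σ c w x l j := by
  rw [preactivation, weights_overwriteLayer_self, embedding_overwriteLayer]

lemma gradGram_overwrite_inr (v : Fin (layerWidth d m L) → ℝ) :
    gradGram σ c (overwrite Sum.inr w v) x z L = gradGram σ c w x z L := by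
  refine (gradGram_congr σ c x z fun l' h' _ => ?_).symm
  ext i j
  refine (Function.extend_apply' v w (weightIdx h' (i, j)) ?_).symm
  simp [weightIdx]

end Resampling

section LayerAverages

variable {d m L : ℕ}

section Unit

variable (σ : ℝ → ℝ) (c : ℝ) (ψ : ℝ → ℝ) {l : ℕ} (h : l < L) (w : Params d m L)
  (x z : EuclideanSpace ℝ (Fin d))

/-- The empirical counterpart of `c ^ 2 * gaussianCov ψ`: the scaled average over the units of
layer `l + 1` of the products of the values of `ψ` at the preactivations of two inputs. -/
def unitAverage : ℝ :=
  c ^ 2 / m * ∑ i, ψ (preactivation σ c w x h i) * ψ (preactivation σ c w z h i)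

lemma embeddingGram_succ :
    embeddingGram σ c w x z (l + 1) = unitAverage σ c σ h w x z := by
  have hscale : c ^ 2 / m = c / √(m : ℝ) * (c / √(m : ℝ)) := by
    rw [div_mul_div_comm, mul_self_sqrt (Nat.cast_nonneg m), sq]
  rw [embeddingGram_eq_sum, unitAverage, Finset.mul_sum]
  refine Finset.sum_congr rfl fun i _ => ?_
  rw [embedding_succ σ c w x h i, embedding_succ σ c w z h i, hscale]
  ring

variable {σ ψ} in
lemma measurable_unitAverage (hσ : Measurable σ) (hψ : Measurable ψ) :
    Measurable fun w : Params d m L => unitAverage σ c ψ h w x z :=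
  (Finset.measurable_sum _ fun i _ => (hψ.comp (measurable_preactivation c x hσ h i)).mul
    (hψ.comp (measurable_preactivation c z hσ h i))).const_mul _

end Unit

section Covariance

variable {ι : Type*} [Fintype ι] {ψ : ℝ → ℝ} (hψ : Measurable ψ)
include hψ

lemma measurable_gaussianCov {Ω : Type*} [MeasurableSpace Ω] {f g : Ω → ι → ℝ}
    (hf : Measurable f) (hg : Measurable g) : Measurable fun w => gaussianCov ψ (f w) (g w) := by
  have hjoint : Measurable fun p : Ω × (ι → ℝ) =>
      ψ (∑ j, p.2 j * f p.1 j) * ψ (∑ j, p.2 j * g p.1 j) :=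
    (hψ.comp (by fun_prop)).mul (hψ.comp (by fun_prop))
  exact hjoint.stronglyMeasurable.integral_prod_right.measurable

variable (hbound : ∀ s t, |ψ s * ψ t| ≤ 1 + |s * t|)
include hbound

omit hψ in
lemma mul_comp_sq_le (s t : ℝ) : (ψ s * ψ t) ^ 2 ≤ 2 + 2 * (s * t) ^ 2 := by
  have hsq := pow_le_pow_left₀ (abs_nonneg _) (hbound s t) 2
  rw [sq_abs] at hsq
  nlinarith [sq_abs (s * t), sq_nonneg (|s * t| - 1)]

lemma memLp_mul_comp_sum_mul (a b : ι → ℝ) :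
    MemLp (fun v => ψ (∑ j, v j * a j) * ψ (∑ j, v j * b j)) 2 (stdGaussianPi ι) := by
  have hmeas : Measurable fun v : ι → ℝ => ψ (∑ j, v j * a j) * ψ (∑ j, v j * b j) :=
    (hψ.comp (by fun_prop)).mul (hψ.comp (by fun_prop))
  refine (memLp_two_iff_integrable_sq hmeas.aestronglyMeasurable).2 <|
    ((integrable_const 2).add ((integrable_sum_mul_sq_mul_sum_mul_sq a b).const_mul 2)).mono'
      (hmeas.pow_const 2).aestronglyMeasurable (ae_of_all _ fun v => ?_)
  rw [norm_of_nonneg (sq_nonneg _)]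
  exact mul_comp_sq_le hbound _ _

lemma integral_mul_comp_sum_mul_sq_le (a b : EuclideanSpace ℝ ι) :
    ∫ v : ι → ℝ, (ψ (∑ j, v j * a j) * ψ (∑ j, v j * b j)) ^ 2 ∂stdGaussianPi ι ≤
      2 + 6 * (‖a‖ * ‖b‖) ^ 2 := by
  have hint := (integrable_sum_mul_sq_mul_sum_mul_sq (α := ι) a b).const_mul 2
  calc ∫ v : ι → ℝ, (ψ (∑ j, v j * a j) * ψ (∑ j, v j * b j)) ^ 2 ∂stdGaussianPi ι
      ≤ ∫ v : ι → ℝ, (2 + 2 * ((∑ j, v j * a j) * (∑ j, v j * b j)) ^ 2) ∂stdGaussianPi ι :=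
        integral_mono (memLp_mul_comp_sum_mul hψ hbound a b).integrable_sq
          ((integrable_const 2).add hint) fun v => mul_comp_sq_le hbound _ _
    _ = 2 + 2 * ∫ v : ι → ℝ, ((∑ j, v j * a j) * (∑ j, v j * b j)) ^ 2 ∂stdGaussianPi ι := by
        rw [integral_add (integrable_const _) hint, integral_const_mul]
        simp
    _ ≤ 2 + 6 * (‖a‖ * ‖b‖) ^ 2 := by
        linarith [integral_sum_mul_sq_mul_sum_mul_sq_le a b]

end Covariance

/-- Events of asymptotically full probability at initialization, as the width tends to infinity. -/
abbrev wideInit (d L : ℕ) : Filter (Σ m, Params d m L) := whp fun m => initLaw d m L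

lemma eventually_width_pos : ∀ᶠ X in wideInit d L, 0 < X.1 :=
  tendsto_fst_whp.eventually_gt_atTop 0

lemma tendsto_inv_width : Tendsto (fun X : Σ m, Params d m L => (X.1 : ℝ)⁻¹) (wideInit d L)
    (𝓝 0) :=
  tendsto_inv_atTop_nhds_zero_nat.comp tendsto_fst_whp

variable {σ ψ : ℝ → ℝ} (c : ℝ) {l : ℕ} (h : l < L) (x z : EuclideanSpace ℝ (Fin d))

/- Given the previous layer, the units of a layer are i.i.d.: this is a law of large numbers. -/
lemma tendsto_unitAverage_sub_gaussianCov (hσ : Measurable σ) (hψ : Measurable ψ)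
    (hbound : ∀ s t, |ψ s * ψ t| ≤ 1 + |s * t|) {gx gz : ℝ}
    (hx : Tendsto (fun X => ‖embedding σ c X.2 x l‖) (wideInit d L) (𝓝 gx))
    (hz : Tendsto (fun X => ‖embedding σ c X.2 z l‖) (wideInit d L) (𝓝 gz)) :
    Tendsto (fun X => unitAverage σ c ψ h X.2 x z -
      c ^ 2 * gaussianCov ψ (embedding σ c X.2 x l) (embedding σ c X.2 z l))
      (wideInit d L) (𝓝 0) := by
  have hB : Tendsto (fun X : Σ m, Params d m L => c ^ 4 * (X.1 : ℝ)⁻¹ *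
      (2 + 6 * (‖embedding σ c X.2 x l‖ * ‖embedding σ c X.2 z l‖) ^ 2)) (wideInit d L) (𝓝 0) := by
    simpa using (tendsto_inv_width.const_mul (c ^ 4)).mul
      ((((hx.mul hz).pow 2).const_mul 6).const_add 2)
  have hmeas (y) (m) : Measurable fun w : Params d m L => (embedding σ c w y l).ofLp :=
    measurable_pi_lambda _ fun j => measurable_embedding c y hσ l j
  refine tendsto_whp_zero_of_resample_sq (fun m => measurePreserving_overwriteLayer h)
    (Y := fun m w => unitAverage σ c ψ h w x z -
      c ^ 2 * gaussianCov ψ (embedding σ c w x l) (embedding σ c w z l))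
    (fun m => (measurable_unitAverage c h x z hσ hψ).sub
      ((measurable_gaussianCov hψ (hmeas x m) (hmeas z m)).const_mul _)) hB ?_
  filter_upwards [eventually_width_pos] with ⟨m, w⟩ hm
  set a := embedding σ c w x l
  set b := embedding σ c w z l
  have hm0 : (m : ℝ) ≠ 0 := Nat.cast_ne_zero.2 hm.ne'
  have hmem := memLp_mul_comp_sum_mul hψ hbound a b
  refine ⟨fun V => (c ^ 2 / m) ^ 2 * (∑ i, (ψ (∑ j, V i j * a j) * ψ (∑ j, V i j * b j) -
      gaussianCov ψ a b)) ^ 2, (memLp_sum_comp_eval_sub hmem _).integrable_sq.const_mul _,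
    fun V => le_of_eq ?_, ?_⟩
  · simp only [unitAverage, preactivation_overwriteLayer, embedding_overwriteLayer,
      Finset.sum_sub_distrib, Finset.sum_const, Finset.card_univ, Fintype.card_fin, nsmul_eq_mul]
    field_simp
    rfl
  · rw [integral_const_mul]
    calc _ ≤ (c ^ 2 / m) ^ 2 * (m * (2 + 6 * (‖a‖ * ‖b‖) ^ 2)) := by
          gcongr
          refine (integral_sum_sub_integral_sq_le hmem).trans ?_
          rw [Fintype.card_fin]
          gcongr
          exact integral_mul_comp_sum_mul_sq_le hψ hbound a b
      _ = c ^ 4 * (m : ℝ)⁻¹ * (2 + 6 * (‖a‖ * ‖b‖) ^ 2) := by field_simp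

end LayerAverages

/-! ### Propagation of the gradient Gram matrix -/

section GradientRecursion

open Matrix

variable {d m L : ℕ} {σ : ℝ → ℝ} (c : ℝ) {l : ℕ} (h : l < L)

section Finite

variable (σ) (w : Params d m L) (x z : EuclideanSpace ℝ (Fin d))

/-- The squared Frobenius norm of the Gram matrix of the gradients of the units of layer `l`. -/
def gradFrobeniusSq (l : ℕ) : ℝ := ∑ i, ∑ k, gradGram σ c w x z l i k ^ 2

lemma gradGram_zero : gradGram σ c w x z 0 = 0 := by
  ext
  simp [gradGram, embeddingGrad]

lemma trace_gradGram_succ_sub :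
    (gradGram σ c w x z (l + 1)).trace - unitAverage σ c (deriv σ) h w x z *
        (embeddingGram σ c w x z l + (gradGram σ c w x z l).trace) =
      c ^ 2 / m * ∑ i : Fin m,
        deriv σ (preactivation σ c w x h i) * deriv σ (preactivation σ c w z h i) *
          (weights w h i ⬝ᵥ gradGram σ c w x z l *ᵥ weights w h i -
            (gradGram σ c w x z l).trace) := by
  have htrace : (gradGram σ c w x z (l + 1)).trace =
      ∑ i : Fin m, gradGram σ c w x z (l + 1) i i := rfl
  simp only [htrace, gradGram_succ σ c w x z h, if_true, unitAverage, Finset.mul_sum,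
    Finset.sum_mul, ← Finset.sum_sub_distrib]
  exact Finset.sum_congr rfl fun i _ => by ring

variable {σ} (hderiv : ∀ t, |deriv σ t| ≤ 1)
include hderiv

lemma deriv_mul_deriv_sq_le_one (s t : ℝ) : (deriv σ s * deriv σ t) ^ 2 ≤ 1 := by
  rw [sq_le_one_iff_abs_le_one, abs_mul]
  exact mul_le_one₀ (hderiv s) (abs_nonneg _) (hderiv t)

lemma trace_gradGram_succ_sub_sq_le :
    ((gradGram σ c w x z (l + 1)).trace - unitAverage σ c (deriv σ) h w x z *
        (embeddingGram σ c w x z l + (gradGram σ c w x z l).trace)) ^ 2 ≤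
      (c ^ 2 / m) ^ 2 * (m * ∑ i : Fin m,
        (weights w h i ⬝ᵥ gradGram σ c w x z l *ᵥ weights w h i -
          (gradGram σ c w x z l).trace) ^ 2) := by
  rw [trace_gradGram_succ_sub, mul_pow]
  gcongr
  refine sq_sum_le_card_mul_sum_sq.trans ?_
  rw [Finset.card_univ, Fintype.card_fin]
  refine mul_le_mul_of_nonneg_left (Finset.sum_le_sum fun i _ => ?_) (Nat.cast_nonneg m)
  rw [mul_pow]
  exact mul_le_of_le_one_left (sq_nonneg _) (deriv_mul_deriv_sq_le_one hderiv _ _)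

lemma gradFrobeniusSq_succ_le :
    gradFrobeniusSq σ c w x z (l + 1) ≤ (c ^ 2 / m) ^ 2 * (2 * ∑ i : Fin m, ∑ k : Fin m,
      ((weights w h i ⬝ᵥ gradGram σ c w x z l *ᵥ weights w h k) ^ 2 +
        if i = k then embeddingGram σ c w x z l ^ 2 else 0)) := by
  have hentry (i k : Fin m) : gradGram σ c w x z (l + 1) i k ^ 2 ≤ (c ^ 2 / m) ^ 2 *
      (2 * ((weights w h i ⬝ᵥ gradGram σ c w x z l *ᵥ weights w h k) ^ 2 +
        if i = k then embeddingGram σ c w x z l ^ 2 else 0)) := by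
    rw [gradGram_succ σ c w x z h, mul_assoc, mul_pow, mul_pow]
    refine mul_le_mul_of_nonneg_left ?_ (sq_nonneg _)
    refine (mul_le_of_le_one_left (sq_nonneg _) (deriv_mul_deriv_sq_le_one hderiv _ _)).trans ?_
    split_ifs
    · exact add_sq_le
    · rw [add_zero, add_zero]
      exact le_mul_of_one_le_left (sq_nonneg _) one_le_two
  simp only [Finset.mul_sum]
  exact Finset.sum_le_sum fun i _ => Finset.sum_le_sum fun k _ => hentry i k

end Finite

variable (x z : EuclideanSpace ℝ (Fin d))

lemma measurable_gradFrobeniusSq (hσ : Measurable σ) (l : ℕ) :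
    Measurable fun w : Params d m L => gradFrobeniusSq σ c w x z l :=
  Finset.measurable_sum _ fun i _ => Finset.measurable_sum _ fun k _ =>
    (measurable_gradGram c x z hσ l i k).pow_const 2

lemma measurable_trace_gradGram (hσ : Measurable σ) (l : ℕ) :
    Measurable fun w : Params d m L => (gradGram σ c w x z l).trace :=
  Finset.measurable_sum _ fun i _ => measurable_gradGram c x z hσ l i i

section Rows

variable {α κ : Type*} [Fintype α] [Fintype κ] (A : Matrix α α ℝ)

lemma integrable_row_sub_trace_sq (i : κ) :
    Integrable (fun V : κ → α → ℝ => (V i ⬝ᵥ A *ᵥ V i - A.trace) ^ 2)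
      (Measure.pi fun _ => stdGaussianPi α) :=
  integrable_comp_eval (μ := fun _ : κ => stdGaussianPi α)
    (f := fun v => (v ⬝ᵥ A *ᵥ v - A.trace) ^ 2)
    ((memLp_dotProduct_mulVec_self A).sub (memLp_const _)).integrable_sq

lemma integral_sum_row_sub_trace_sq_le :
    ∫ V : κ → α → ℝ, ∑ i, (V i ⬝ᵥ A *ᵥ V i - A.trace) ^ 2 ∂Measure.pi (fun _ => stdGaussianPi α) ≤
      Fintype.card κ * (2 * ∑ a, ∑ b, A a b ^ 2) := by
  classical
  have hrow (i : κ) : ∫ V : κ → α → ℝ, (V i ⬝ᵥ A *ᵥ V i - A.trace) ^ 2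
      ∂Measure.pi (fun _ => stdGaussianPi α) ≤ 2 * ∑ a, ∑ b, A a b ^ 2 := by
    rw [integral_comp_eval (μ := fun _ : κ => stdGaussianPi α)
      (f := fun v => (v ⬝ᵥ A *ᵥ v - A.trace) ^ 2)
      ((memLp_dotProduct_mulVec_self A).sub (memLp_const _)).integrable_sq.aestronglyMeasurable]
    exact integral_dotProduct_mulVec_self_sub_trace_sq_le A
  rw [integral_finsetSum _ fun i _ => integrable_row_sub_trace_sq A i, ← nsmul_eq_mul]
  exact Finset.sum_le_card_nsmul _ _ _ fun i _ => hrow i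

variable [DecidableEq κ] (G : ℝ)

lemma integrable_sum_row_sq_add :
    Integrable (fun V : κ → α → ℝ => ∑ i, ∑ k,
      ((V i ⬝ᵥ A *ᵥ V k) ^ 2 + if i = k then G ^ 2 else 0))
      (Measure.pi fun _ => stdGaussianPi α) :=
  integrable_finsetSum _ fun i _ => integrable_finsetSum _ fun k _ =>
    (integrable_row_dotProduct_mulVec_row_sq A i k).add (integrable_const _)

lemma integral_sum_row_sq_add_le :
    ∫ V : κ → α → ℝ, ∑ i, ∑ k, ((V i ⬝ᵥ A *ᵥ V k) ^ 2 + if i = k then G ^ 2 else 0)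
        ∂Measure.pi (fun _ => stdGaussianPi α) ≤
      Fintype.card κ * (A.trace ^ 2 + G ^ 2) +
        (Fintype.card κ : ℝ) ^ 2 * (2 * ∑ a, ∑ b, A a b ^ 2) := by
  have hint (i k : κ) : Integrable (fun V : κ → α → ℝ =>
      (V i ⬝ᵥ A *ᵥ V k) ^ 2 + if i = k then G ^ 2 else 0)
      (Measure.pi fun _ => stdGaussianPi α) :=
    (integrable_row_dotProduct_mulVec_row_sq A i k).add (integrable_const _)
  calc _ = ∑ i, ∑ k, ∫ V : κ → α → ℝ, ((V i ⬝ᵥ A *ᵥ V k) ^ 2 + if i = k then G ^ 2 else 0)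
        ∂Measure.pi (fun _ => stdGaussianPi α) := by
        rw [integral_finsetSum _ fun i _ => integrable_finsetSum _ fun k _ => hint i k]
        exact Finset.sum_congr rfl fun i _ => integral_finsetSum _ fun k _ => hint i k
    _ ≤ ∑ i : κ, ∑ k : κ, ((if i = k then A.trace ^ 2 else 0) + 2 * (∑ a, ∑ b, A a b ^ 2) +
          if i = k then G ^ 2 else 0) := by
        gcongr with i _ k _
        rw [integral_add (integrable_row_dotProduct_mulVec_row_sq A i k) (integrable_const _),
          integral_const, probReal_univ, one_smul]
        gcongr
        exact integral_row_dotProduct_mulVec_row_sq_le A i k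
    _ = _ := by
        simp only [Finset.sum_add_distrib, Finset.sum_ite_eq, Finset.mem_univ, if_true,
          Finset.sum_const, Finset.card_univ, nsmul_eq_mul]
        ring

end Rows

variable (hσ : Measurable σ) (hderiv : ∀ t, |deriv σ t| ≤ 1)
include hσ hderiv

lemma tendsto_trace_gradGram_succ_sub
    (hF : Tendsto (fun X => gradFrobeniusSq σ c X.2 x z l) (wideInit d L) (𝓝 0)) :
    Tendsto (fun X => (gradGram σ c X.2 x z (l + 1)).trace -
      unitAverage σ c (deriv σ) h X.2 x z *
        (embeddingGram σ c X.2 x z l + (gradGram σ c X.2 x z l).trace)) (wideInit d L) (𝓝 0) := by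
  have hB : Tendsto (fun X : Σ m, Params d m L => c ^ 4 * (2 * gradFrobeniusSq σ c X.2 x z l))
      (wideInit d L) (𝓝 0) := by simpa using (hF.const_mul 2).const_mul (c ^ 4)
  refine tendsto_whp_zero_of_resample_sq (fun m => measurePreserving_overwriteLayer h)
    (Y := fun m w => (gradGram σ c w x z (l + 1)).trace - unitAverage σ c (deriv σ) h w x z *
      (embeddingGram σ c w x z l + (gradGram σ c w x z l).trace))
    (fun m => (measurable_trace_gradGram c x z hσ _).sub
      ((measurable_unitAverage c h x z hσ (measurable_deriv σ)).mul
        ((measurable_embeddingGram c x z hσ l).add (measurable_trace_gradGram c x z hσ l)))) hB ?_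
  filter_upwards [eventually_width_pos] with ⟨m, w⟩ hm
  have hm0 : (m : ℝ) ≠ 0 := Nat.cast_ne_zero.2 hm.ne'
  set A := gradGram σ c w x z l with hA
  refine ⟨fun V => (c ^ 2 / m) ^ 2 * (m * ∑ i : Fin m, (V i ⬝ᵥ A *ᵥ V i - A.trace) ^ 2),
    ((integrable_finsetSum _ fun i _ => integrable_row_sub_trace_sq A i).const_mul _).const_mul _,
    fun V => ?_, ?_⟩
  · have hle := trace_gradGram_succ_sub_sq_le c h (overwriteLayer h w V) x z hderiv
    simpa only [weights_overwriteLayer_self, gradGram_overwriteLayer] using hle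
  · rw [integral_const_mul, integral_const_mul]
    calc _ ≤ (c ^ 2 / m) ^ 2 * (m * (m * (2 * ∑ a, ∑ b, A a b ^ 2))) := by
          gcongr
          simpa only [Fintype.card_fin] using integral_sum_row_sub_trace_sq_le (κ := Fin m) A
      _ = c ^ 4 * (2 * gradFrobeniusSq σ c w x z l) := by
          rw [gradFrobeniusSq, ← hA]
          field_simp

include h in
lemma tendsto_gradFrobeniusSq_succ {r τ : ℝ}
    (hr : Tendsto (fun X => embeddingGram σ c X.2 x z l) (wideInit d L) (𝓝 r))
    (hτ : Tendsto (fun X => (gradGram σ c X.2 x z l).trace) (wideInit d L) (𝓝 τ))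
    (hF : Tendsto (fun X => gradFrobeniusSq σ c X.2 x z l) (wideInit d L) (𝓝 0)) :
    Tendsto (fun X => gradFrobeniusSq σ c X.2 x z (l + 1)) (wideInit d L) (𝓝 0) := by
  have hB : Tendsto (fun X : Σ m, Params d m L => 2 * c ^ 4 *
      ((X.1 : ℝ)⁻¹ * ((gradGram σ c X.2 x z l).trace ^ 2 + embeddingGram σ c X.2 x z l ^ 2) +
        2 * gradFrobeniusSq σ c X.2 x z l)) (wideInit d L) (𝓝 0) := by
    simpa using ((tendsto_inv_width.mul ((hτ.pow 2).add (hr.pow 2))).add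
      (hF.const_mul 2)).const_mul (2 * c ^ 4)
  refine tendsto_whp_zero_of_resample (fun m => measurePreserving_overwriteLayer h)
    (Y := fun m w => gradFrobeniusSq σ c w x z (l + 1))
    (fun m => measurable_gradFrobeniusSq c x z hσ _)
    (fun m w => Finset.sum_nonneg fun _ _ => Finset.sum_nonneg fun _ _ => sq_nonneg _) hB ?_
  filter_upwards [eventually_width_pos] with ⟨m, w⟩ hm
  have hm0 : (m : ℝ) ≠ 0 := Nat.cast_ne_zero.2 hm.ne'
  set A := gradGram σ c w x z l with hA
  set G := embeddingGram σ c w x z l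
  refine ⟨fun V => (c ^ 2 / m) ^ 2 * (2 * ∑ i : Fin m, ∑ k : Fin m,
      ((V i ⬝ᵥ A *ᵥ V k) ^ 2 + if i = k then G ^ 2 else 0)),
    ((integrable_sum_row_sq_add A G).const_mul _).const_mul _, fun V => ?_, ?_⟩
  · have hle := gradFrobeniusSq_succ_le c h (overwriteLayer h w V) x z hderiv
    rwa [weights_overwriteLayer_self, gradGram_overwriteLayer,
      embeddingGram_overwriteLayer] at hle
  · rw [integral_const_mul, integral_const_mul]
    calc _ ≤ (c ^ 2 / m) ^ 2 * (2 * (m * (A.trace ^ 2 + G ^ 2) +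
            (m : ℝ) ^ 2 * (2 * ∑ a, ∑ b, A a b ^ 2))) := by
          gcongr
          simpa only [Fintype.card_fin] using integral_sum_row_sq_add_le (κ := Fin m) A G
      _ = 2 * c ^ 4 * ((m : ℝ)⁻¹ * (A.trace ^ 2 + G ^ 2) + 2 * gradFrobeniusSq σ c w x z l) := by
          rw [gradFrobeniusSq, ← hA]
          field_simp

omit hderiv in
lemma tendsto_inner_networkGrad_sub
    (hF : Tendsto (fun X => gradFrobeniusSq σ c X.2 x z L) (wideInit d L) (𝓝 0)) :
    Tendsto (fun X => inner ℝ (networkGrad σ c X.2 x) (networkGrad σ c X.2 z) -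
      (embeddingGram σ c X.2 x z L + (gradGram σ c X.2 x z L).trace)) (wideInit d L) (𝓝 0) := by
  have hdecomp (m : ℕ) (w : Params d m L) :
      inner ℝ (networkGrad σ c w x) (networkGrad σ c w z) -
          (embeddingGram σ c w x z L + (gradGram σ c w x z L).trace) =
        (fun j => w (Sum.inr j)) ⬝ᵥ gradGram σ c w x z L *ᵥ (fun j => w (Sum.inr j)) -
          (gradGram σ c w x z L).trace := by
    rw [inner_networkGrad]
    ring
  have hmeas (m : ℕ) : Measurable fun w : Params d m L =>
      (fun j => w (Sum.inr j)) ⬝ᵥ gradGram σ c w x z L *ᵥ (fun j => w (Sum.inr j)) :=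
    Finset.measurable_sum _ fun i _ => Measurable.mul (g := fun w : Params d m L =>
        ∑ k, gradGram σ c w x z L i k * w (Sum.inr k)) (by fun_prop) <|
      Finset.measurable_sum _ fun k _ => (measurable_gradGram c x z hσ L i k).mul (by fun_prop)
  simp only [hdecomp]
  refine tendsto_whp_zero_of_resample_sq
    (fun m => measurePreserving_overwrite (d := d) (m := m) (L := L) Sum.inr_injective)
    (Y := fun m w => (fun j => w (Sum.inr j)) ⬝ᵥ gradGram σ c w x z L *ᵥ
      (fun j => w (Sum.inr j)) - (gradGram σ c w x z L).trace)
    (fun m => (hmeas m).sub (measurable_trace_gradGram c x z hσ L))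
    (by simpa using hF.const_mul 2) (Eventually.of_forall fun ⟨m, w⟩ => ?_)
  refine ⟨_, ((memLp_dotProduct_mulVec_self (gradGram σ c w x z L)).sub
    (memLp_const _)).integrable_sq, fun v => le_of_eq ?_,
    integral_dotProduct_mulVec_self_sub_trace_sq_le _⟩
  have hout : (fun j => overwrite Sum.inr w v (Sum.inr j)) = v :=
    funext (Sum.inr_injective.extend_apply v w)
  simp only [gradGram_overwrite_inr, hout, Pi.sub_apply]

end GradientRecursion

/-! ### The infinite width limit -/

section InfiniteWidth

/-- The Gaussian covariances of the activation `σ`, scaled by `c`, are given by the homogeneous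
kernel `k₁`, and those of its derivative by `k₀`, as functions of the cosine of the angle between
the inputs. The normalization `k₁ 1 = k₀ 1 = 1` makes the network norm preserving on average; the
remaining fields are the regularity of `σ` needed to pass to the infinite width limit. -/
structure HasGaussianKernels (σ : ℝ → ℝ) (c : ℝ) (k₁ k₀ : ℝ → ℝ) : Prop where
  measurable : Measurable σ
  abs_le (t : ℝ) : |σ t| ≤ |t|
  abs_deriv_le (t : ℝ) : |deriv σ t| ≤ 1
  differentiableAt (t : ℝ) : t ≠ 0 → DifferentiableAt ℝ σ t
  continuous_kernel : Continuous k₁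
  continuous_derivKernel : Continuous k₀
  kernel_one : k₁ 1 = 1
  derivKernel_one : k₀ 1 = 1
  gaussianCov_eq {n : ℕ} (a b : EuclideanSpace ℝ (Fin n)) : a ≠ 0 → b ≠ 0 →
    c ^ 2 * gaussianCov σ a b = ‖a‖ * ‖b‖ * k₁ (cos (angle a b))
  gaussianCov_deriv_eq {n : ℕ} (a b : EuclideanSpace ℝ (Fin n)) : a ≠ 0 → b ≠ 0 →
    c ^ 2 * gaussianCov (deriv σ) a b = k₀ (cos (angle a b))

/-- The neural tangent kernel of a network with `L` hidden layers at unit inputs with inner product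
`t`: the limit of the inner product of the two model gradients. -/
def tangentKernel (k₁ k₀ : ℝ → ℝ) (t : ℝ) : ℕ → ℝ
  | 0 => t
  | L + 1 => k₁^[L + 1] t + tangentKernel k₁ k₀ t L * k₀ (k₁^[L] t)

lemma tangentKernel_one {k₁ k₀ : ℝ → ℝ} (h₁ : k₁ 1 = 1) (h₀ : k₀ 1 = 1) (L : ℕ) :
    tangentKernel k₁ k₀ 1 L = L + 1 := by
  induction L with
  | zero => simp [tangentKernel]
  | succ L ih =>
    rw [tangentKernel, ih, Function.iterate_fixed h₁, Function.iterate_fixed h₁, h₀]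
    push_cast
    ring

variable {σ : ℝ → ℝ} {c : ℝ} {d L : ℕ} {x z : EuclideanSpace ℝ (Fin d)}

lemma tendsto_norm_embedding {l : ℕ}
    (hx : Tendsto (fun X => embeddingGram σ c X.2 x x l) (wideInit d L) (𝓝 (‖x‖ ^ 2))) :
    Tendsto (fun X => ‖embedding σ c X.2 x l‖) (wideInit d L) (𝓝 ‖x‖) := by
  have hsqrt := (continuous_sqrt.tendsto _).comp hx
  rw [sqrt_sq (norm_nonneg x)] at hsqrt
  refine hsqrt.congr fun X => ?_
  rw [Function.comp_apply, embeddingGram, real_inner_self_eq_norm_sq, sqrt_sq (norm_nonneg _)]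

lemma tendsto_unitAverage {ψ : ℝ → ℝ} {l : ℕ} (h : l < L) (hσ : Measurable σ)
    (hψ : Measurable ψ) (hbound : ∀ s t, |ψ s * ψ t| ≤ 1 + |s * t|) {K : ℝ → ℝ}
    (hK : Continuous K) {p : ℕ}
    (hcov : ∀ {n : ℕ} (a b : EuclideanSpace ℝ (Fin n)), a ≠ 0 → b ≠ 0 →
      c ^ 2 * gaussianCov ψ a b = (‖a‖ * ‖b‖) ^ p * K (cos (angle a b)))
    (hx0 : x ≠ 0) (hz0 : z ≠ 0) {ρ : ℝ}
    (hx : Tendsto (fun X => embeddingGram σ c X.2 x x l) (wideInit d L) (𝓝 (‖x‖ ^ 2)))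
    (hz : Tendsto (fun X => embeddingGram σ c X.2 z z l) (wideInit d L) (𝓝 (‖z‖ ^ 2)))
    (hxz : Tendsto (fun X => embeddingGram σ c X.2 x z l) (wideInit d L) (𝓝 (‖x‖ * ‖z‖ * ρ))) :
    Tendsto (fun X => unitAverage σ c ψ h X.2 x z) (wideInit d L)
      (𝓝 ((‖x‖ * ‖z‖) ^ p * K ρ)) := by
  have hnx := tendsto_norm_embedding hx
  have hnz := tendsto_norm_embedding hz
  have hx' := norm_ne_zero_iff.2 hx0
  have hz' := norm_ne_zero_iff.2 hz0
  have hcos : Tendsto (fun X => cos (angle (embedding σ c X.2 x l) (embedding σ c X.2 z l)))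
      (wideInit d L) (𝓝 ρ) := by
    simp only [cos_angle]
    have hdiv := hxz.div (hnx.mul hnz) (mul_ne_zero hx' hz')
    rwa [mul_div_cancel_left₀ _ (mul_ne_zero hx' hz')] at hdiv
  have hlimit := ((hnx.mul hnz).pow p).mul ((hK.tendsto ρ).comp hcos)
  refine (zero_add ((‖x‖ * ‖z‖) ^ p * K ρ) ▸
    (tendsto_unitAverage_sub_gaussianCov c h x z hσ hψ hbound hnx hnz).add hlimit).congr' ?_
  filter_upwards [hnx.eventually_ne hx', hnz.eventually_ne hz'] with X hX hZ
  rw [hcov _ _ (norm_ne_zero_iff.1 hX) (norm_ne_zero_iff.1 hZ)]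
  exact sub_add_cancel _ _

variable {k₁ k₀ : ℝ → ℝ} (hk : HasGaussianKernels σ c k₁ k₀)
include hk

lemma tendsto_embeddingGram {l : ℕ} (hl : l ≤ L) {x z : EuclideanSpace ℝ (Fin d)}
    (hx : x ≠ 0) (hz : z ≠ 0) :
    Tendsto (fun X => embeddingGram σ c X.2 x z l) (wideInit d L)
      (𝓝 (‖x‖ * ‖z‖ * k₁^[l] (cos (angle x z)))) := by
  induction l generalizing x z with
  | zero =>
    refine tendsto_const_nhds.congr fun X => ?_
    rw [Function.iterate_zero_apply, mul_comm, cos_angle_mul_norm_mul_norm]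
    rfl
  | succ l ih =>
    have hself {y : EuclideanSpace ℝ (Fin d)} (hy : y ≠ 0) :
        Tendsto (fun X => embeddingGram σ c X.2 y y l) (wideInit d L) (𝓝 (‖y‖ ^ 2)) := by
      have hyy := ih (Nat.le_of_succ_le hl) hy hy
      rwa [angle_self hy, cos_zero, Function.iterate_fixed hk.kernel_one, mul_one, ← sq] at hyy
    simp only [embeddingGram_succ σ c hl, Function.iterate_succ_apply']
    have hbound (s t : ℝ) : |σ s * σ t| ≤ 1 + |s * t| := by
      rw [abs_mul, abs_mul]
      linarith [mul_le_mul (hk.abs_le s) (hk.abs_le t) (abs_nonneg _) (abs_nonneg _)]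
    simpa only [pow_one] using tendsto_unitAverage hl hk.measurable hk.measurable hbound
      hk.continuous_kernel (p := 1)
      (fun a b => by simpa only [pow_one] using hk.gaussianCov_eq a b) hx hz (hself hx) (hself hz)
      (ih (Nat.le_of_succ_le hl) hx hz)

lemma tendsto_embeddingGram_self {l : ℕ} (hl : l ≤ L) (hx : x ≠ 0) :
    Tendsto (fun X => embeddingGram σ c X.2 x x l) (wideInit d L) (𝓝 (‖x‖ ^ 2)) := by
  have hxx := tendsto_embeddingGram hk hl hx hx
  rwa [angle_self hx, cos_zero, Function.iterate_fixed hk.kernel_one, mul_one, ← sq] at hxx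

lemma tendsto_unitAverage_deriv {l : ℕ} (h : l < L) (hx : x ≠ 0) (hz : z ≠ 0) :
    Tendsto (fun X => unitAverage σ c (deriv σ) h X.2 x z) (wideInit d L)
      (𝓝 (k₀ (k₁^[l] (cos (angle x z))))) := by
  have hbound (s t : ℝ) : |deriv σ s * deriv σ t| ≤ 1 + |s * t| := by
    rw [abs_mul]
    exact (mul_le_one₀ (hk.abs_deriv_le s) (abs_nonneg _) (hk.abs_deriv_le t)).trans
      (le_add_of_nonneg_right (abs_nonneg _))
  simpa only [pow_zero, one_mul] using tendsto_unitAverage h hk.measurable (measurable_deriv σ)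
    hbound hk.continuous_derivKernel (p := 0)
    (fun a b => by simpa only [pow_zero, one_mul] using hk.gaussianCov_deriv_eq a b) hx hz
    (tendsto_embeddingGram_self hk h.le hx) (tendsto_embeddingGram_self hk h.le hz)
    (tendsto_embeddingGram hk h.le hx hz)

lemma tendsto_trace_gradGram_gradFrobeniusSq {l : ℕ} (hl : l ≤ L) (hx : x ≠ 0) (hz : z ≠ 0) :
    Tendsto (fun X => (gradGram σ c X.2 x z l).trace) (wideInit d L)
      (𝓝 (‖x‖ * ‖z‖ *
        (tangentKernel k₁ k₀ (cos (angle x z)) l - k₁^[l] (cos (angle x z))))) ∧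
    Tendsto (fun X => gradFrobeniusSq σ c X.2 x z l) (wideInit d L) (𝓝 0) := by
  induction l with
  | zero =>
    simp only [gradFrobeniusSq, gradGram_zero, tangentKernel, Matrix.trace_zero, Matrix.zero_apply,
      Function.iterate_zero_apply, sub_self, mul_zero, zero_pow two_ne_zero,
      Finset.sum_const_zero]
    exact ⟨tendsto_const_nhds, tendsto_const_nhds⟩
  | succ l ih =>
    obtain ⟨htrace, hfrob⟩ := ih (Nat.le_of_succ_le hl)
    have hgram := tendsto_embeddingGram hk (Nat.le_of_succ_le hl) hx hz
    refine ⟨?_, tendsto_gradFrobeniusSq_succ c hl x z hk.measurable hk.abs_deriv_le hgram htrace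
      hfrob⟩
    have hsum := (tendsto_trace_gradGram_succ_sub c hl x z hk.measurable hk.abs_deriv_le
      hfrob).add ((tendsto_unitAverage_deriv hk hl hx hz).mul (hgram.add htrace))
    simp only [sub_add_cancel] at hsum
    convert! hsum using 2
    rw [tangentKernel]
    ring

lemma tendsto_inner_networkGrad (hx : x ≠ 0) (hz : z ≠ 0) :
    Tendsto (fun X => inner ℝ (networkGrad σ c X.2 x) (networkGrad σ c X.2 z)) (wideInit d L)
      (𝓝 (‖x‖ * ‖z‖ * tangentKernel k₁ k₀ (cos (angle x z)) L)) := by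
  obtain ⟨htrace, hfrob⟩ := tendsto_trace_gradGram_gradFrobeniusSq hk (le_refl L) hx hz
  have hsum := (tendsto_inner_networkGrad_sub c x z hk.measurable hfrob).add
    ((tendsto_embeddingGram hk le_rfl hx hz).add htrace)
  simp only [sub_add_cancel] at hsum
  convert! hsum using 2
  ring

lemma tendsto_norm_networkGrad (hx : x ≠ 0) :
    Tendsto (fun X => ‖networkGrad σ c X.2 x‖) (wideInit d L) (𝓝 (‖x‖ * √(L + 1))) := by
  have hsqrt := (continuous_sqrt.tendsto _).comp (tendsto_inner_networkGrad (L := L) hk hx hx)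
  rw [angle_self hx, cos_zero, tangentKernel_one hk.kernel_one hk.derivKernel_one,
    sqrt_mul (mul_self_nonneg _), sqrt_mul_self (norm_nonneg x)] at hsqrt
  refine hsqrt.congr fun X => ?_
  rw [Function.comp_apply, real_inner_self_eq_norm_sq, sqrt_sq (norm_nonneg _)]

lemma tendsto_cos_angle_networkGrad (hx : x ≠ 0) (hz : z ≠ 0) :
    Tendsto (fun X => cos (angle (networkGrad σ c X.2 x) (networkGrad σ c X.2 z))) (wideInit d L)
      (𝓝 (tangentKernel k₁ k₀ (cos (angle x z)) L / (L + 1))) := by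
  have hL : (0 : ℝ) < L + 1 := by positivity
  have hx' := norm_ne_zero_iff.2 hx
  have hz' := norm_ne_zero_iff.2 hz
  have hroot := (sqrt_pos.2 hL).ne'
  have hdiv := (tendsto_inner_networkGrad hk hx hz).div
    ((tendsto_norm_networkGrad hk hx).mul (tendsto_norm_networkGrad hk hz))
    (mul_ne_zero (mul_ne_zero hx' hroot) (mul_ne_zero hz' hroot))
  rw [mul_mul_mul_comm, mul_self_sqrt hL.le, mul_div_mul_left _ _ (mul_ne_zero hx' hz')] at hdiv
  exact hdiv.congr fun X => (cos_angle _ _).symm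

/- Where the previous embedding does not vanish, each preactivation of the layer is a nondegenerate
Gaussian given the previous layers. -/
lemma eventually_preactivation_layer_ne_zero (hx : x ≠ 0) {l : ℕ} (h : l < L) :
    ∀ᶠ X in wideInit d L, ∀ i, preactivation σ c X.2 x h i ≠ 0 := by
  let degenerate (m : ℕ) : Set (Params d m L) :=
    {w | embeddingGram σ c w x x l ≠ 0} ∩ ⋃ i, {w | preactivation σ c w x h i = 0}
  have hmeas (m : ℕ) : MeasurableSet (degenerate m) :=
    ((measurable_embeddingGram c x x hk.measurable l) (measurableSet_singleton 0)).compl.inter <|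
      .iUnion fun i => measurable_preactivation c x hk.measurable h i (measurableSet_singleton 0)
  have hnull (m : ℕ) (w : Params d m L) :
      (Measure.pi fun _ => stdGaussianPi (Fin (layerWidth d m l)))
        {V | overwriteLayer h w V ∈ degenerate m} = 0 := by
    by_cases ha : embedding σ c w x l = 0
    · have hgram : embeddingGram σ c w x x l = 0 := by rw [embeddingGram, ha, inner_zero_left]
      refine measure_mono_null (fun V hV => hV.1 ?_) measure_empty
      rw [embeddingGram_overwriteLayer, hgram]
    refine measure_mono_null (t := ⋃ i, {V | ∑ j, V i j * embedding σ c w x l j = 0})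
      (fun V hV => ?_) (measure_iUnion_null fun i => ?_)
    · obtain ⟨i, hi⟩ := mem_iUnion.1 hV.2
      exact mem_iUnion.2 ⟨i, (preactivation_overwriteLayer h σ c w x V i).symm.trans hi⟩
    · exact (measurePreserving_eval (fun _ : Fin m => stdGaussianPi (Fin (layerWidth d m l)))
        i).quasiMeasurePreserving.preimage_null (stdGaussianPi_sum_mul_eq_zero ha)
  filter_upwards [eventually_whp_notMem_of_resample
      (fun m => measurePreserving_overwriteLayer (d := d) (m := m) h) hmeas
      (tendsto_const_nhds.congr fun X => (hnull X.1 X.2).symm),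
    (tendsto_embeddingGram_self hk h.le hx).eventually_ne (pow_ne_zero 2 (norm_ne_zero_iff.2 hx))]
    with X hX hgram i hi
  exact hX ⟨hgram, mem_iUnion.2 ⟨i, hi⟩⟩

lemma eventually_preactivation_ne_zero (hx : x ≠ 0) :
    ∀ᶠ X in wideInit d L, ∀ l (h : l < L) i, preactivation σ c X.2 x h i ≠ 0 := by
  filter_upwards [eventually_all.2 fun l : Fin L =>
    eventually_preactivation_layer_ne_zero hk hx l.2] with X hX l h i
  exact hX ⟨l, h⟩ i

omit hk in
lemma isInfiniteWidthAngle_of_tendsto {φ : ℝ}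
    (h : Tendsto (fun X => modelGradientAngle σ c X.2 x z) (wideInit d L) (𝓝 φ)) :
    IsInfiniteWidthAngle σ c L x z φ := by
  intro ε hε
  have hclose := eventually_whp.1 (Metric.tendsto_nhds.1 h ε hε)
  simpa only [Real.dist_eq, not_lt] using hclose

theorem isInfiniteWidthAngle_arccos (hx : x ≠ 0) (hz : z ≠ 0) :
    IsInfiniteWidthAngle σ c L x z
      (arccos (tangentKernel k₁ k₀ (cos (angle x z)) L / (L + 1))) := by
  refine isInfiniteWidthAngle_of_tendsto <|
    ((continuous_arccos.tendsto _).comp (tendsto_cos_angle_networkGrad hk hx hz)).congr' ?_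
  filter_upwards [eventually_preactivation_ne_zero hk hx, eventually_preactivation_ne_zero hk hz]
    with X hX hZ
  rw [modelGradientAngle, modelGradient_eq_networkGrad hk.differentiableAt hX,
    modelGradient_eq_networkGrad hk.differentiableAt hZ, Function.comp_apply,
    arccos_cos (angle_nonneg _ _) (angle_le_pi _ _)]

end InfiniteWidth

section Activations

open Matrix

lemma relu_eventuallyEq_id {t : ℝ} (ht : 0 < t) : (fun t : ℝ => max 0 t) =ᶠ[𝓝 t] id := by
  filter_upwards [lt_mem_nhds ht] with s hs
  exact max_eq_right hs.le

lemma deriv_relu (t : ℝ) : deriv (fun t : ℝ => max 0 t) t = if 0 < t then 1 else 0 := by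
  split_ifs with ht
  · rw [(relu_eventuallyEq_id ht).deriv_eq, deriv_id]
  · -- every nonpositive point is a minimum, including the kink
    refine IsLocalMin.deriv_eq_zero (Eventually.of_forall fun s => ?_)
    exact (max_eq_left (not_lt.1 ht)).trans_le (le_max_left 0 s)

lemma differentiableAt_relu {t : ℝ} (ht : t ≠ 0) :
    DifferentiableAt ℝ (fun t : ℝ => max 0 t) t := by
  rcases ht.lt_or_gt with hneg | hpos
  · refine (differentiableAt_const (0 : ℝ)).congr_of_eventuallyEq ?_
    filter_upwards [gt_mem_nhds hneg] with s hs
    exact max_eq_left hs.le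
  · exact differentiableAt_id.congr_of_eventuallyEq (relu_eventuallyEq_id hpos)

lemma hasGaussianKernels_relu :
    HasGaussianKernels (fun t => max 0 t) (√2) arccosKernelOne arccosKernelZero where
  measurable := by fun_prop
  abs_le t := by
    rw [abs_of_nonneg (le_max_left _ _)]
    exact max_le (abs_nonneg t) (le_abs_self t)
  abs_deriv_le t := by
    rw [deriv_relu]
    split_ifs <;> simp
  differentiableAt _ := differentiableAt_relu
  continuous_kernel := by
    unfold arccosKernelOne
    have := continuous_arccos
    fun_prop
  continuous_derivKernel := by
    unfold arccosKernelZero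
    have := continuous_arccos
    fun_prop
  kernel_one := by simp [arccosKernelOne]
  derivKernel_one := by simp [arccosKernelZero]
  gaussianCov_eq a b ha hb := by
    rw [gaussianCov_relu ha hb, sq_sqrt zero_le_two]
    ring
  gaussianCov_deriv_eq a b ha hb := by
    rw [funext deriv_relu, gaussianCov_step ha hb, sq_sqrt zero_le_two]
    ring

lemma hasGaussianKernels_linear :
    HasGaussianKernels (fun t => t) 1 (fun t => t) (fun _ => 1) where
  measurable := measurable_id
  abs_le _ := le_rfl
  abs_deriv_le _ := by simp
  differentiableAt _ _ := differentiableAt_id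
  continuous_kernel := continuous_id
  continuous_derivKernel := continuous_const
  kernel_one := rfl
  derivKernel_one := rfl
  gaussianCov_eq a b _ _ := by
    simp only [gaussianCov, sum_mul_mul_sum_mul_eq_dotProduct_mulVec,
      integral_dotProduct_mulVec_self, trace_vecMulVec]
    rw [mul_comm (‖a‖ * ‖b‖), cos_angle_mul_norm_mul_norm]
    simp [PiLp.inner_apply, dotProduct, mul_comm]
  gaussianCov_deriv_eq a b _ _ := by simp [gaussianCov]

lemma tangentKernel_linear (t : ℝ) (L : ℕ) :
    tangentKernel (fun t => t) (fun _ => 1) t L = (L + 1) * t := by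
  induction L with
  | zero => simp [tangentKernel]
  | succ L ih =>
    rw [tangentKernel, ih, Function.iterate_fixed rfl]
    push_cast
    ring

variable {d L : ℕ} {x z : EuclideanSpace ℝ (Fin d)}

theorem isLinearAngle_angle (hx : x ≠ 0) (hz : z ≠ 0) : IsLinearAngle L x z (angle x z) := by
  have hlim := isInfiniteWidthAngle_arccos (L := L) hasGaussianKernels_linear hx hz
  rwa [tangentKernel_linear, mul_div_cancel_left₀ _ (Nat.cast_add_one_ne_zero L),
    arccos_cos (angle_nonneg x z) (angle_le_pi x z)] at hlim

/-- The neural tangent kernel of the ReLU network with `L` hidden layers at two unit inputs at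
angle `θ`. -/
def reluKernel (L : ℕ) (θ : ℝ) : ℝ := tangentKernel arccosKernelOne arccosKernelZero (cos θ) L

/-- The model gradient angle of the infinitely wide ReLU network with `L` hidden layers, as a
function of the input angle. -/
def reluAngle (L : ℕ) (θ : ℝ) : ℝ := arccos (reluKernel L θ / (L + 1))

theorem isReLUAngle_reluAngle (hx : x ≠ 0) (hz : z ≠ 0) :
    IsReLUAngle L x z (reluAngle L (angle x z)) :=
  isInfiniteWidthAngle_arccos hasGaussianKernels_relu hx hz

end Activations

/-! ### Depth dependence of the ReLU kernel -/

section Trigonometry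

lemma mul_cos_le_sin {θ : ℝ} (h0 : 0 ≤ θ) (hπ : θ ≤ π) : θ * cos θ ≤ sin θ := by
  rcases lt_or_ge θ (π / 2) with h | h
  · have htan := le_tan h0 h
    rwa [tan_eq_sin_div_cos,
      le_div_iff₀ (cos_pos_of_mem_Ioo ⟨by linarith [pi_pos], h⟩)] at htan
  · have hcos := cos_nonpos_of_pi_div_two_le_of_le h (by linarith)
    exact (mul_nonpos_of_nonneg_of_nonpos h0 hcos).trans (sin_nonneg_of_nonneg_of_le_pi h0 hπ)

lemma two_div_pi_sq_mul_le_cos_sub_cos {s t : ℝ} (hst : |s| ≤ t) (hπ : t + |s| ≤ π) :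
    2 / π ^ 2 * (t ^ 2 - s ^ 2) ≤ cos s - cos t := by
  have := le_abs_self s
  have := neg_abs_le s
  have hadd := mul_le_sin (x := (t + s) / 2) (by linarith) (by linarith)
  have hsub := mul_le_sin (x := (t - s) / 2) (by linarith) (by linarith)
  have hnonneg (r : ℝ) (hr : 0 ≤ r) : 0 ≤ 2 / π * (r / 2) := by positivity
  calc 2 / π ^ 2 * (t ^ 2 - s ^ 2) = 2 * (2 / π * ((t + s) / 2) * (2 / π * ((t - s) / 2))) := by
        field_simp
        ring
    _ ≤ 2 * (sin ((t + s) / 2) * sin ((t - s) / 2)) := by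
        gcongr
        · exact hnonneg _ (by linarith)
        · exact (hnonneg _ (by linarith)).trans hadd
    _ = cos s - cos t := by
        rw [cos_sub_cos, ← neg_sub t s, neg_div, sin_neg, add_comm s t]
        ring

end Trigonometry

section AngleMap

/-- The angle between the embeddings of two inputs in the layer of an infinitely wide ReLU network
following a layer in which this angle is `θ`. -/
def angleMap (θ : ℝ) : ℝ := arccos (arccosKernelOne (cos θ))

variable {θ : ℝ} (h0 : 0 ≤ θ) (hπ : θ ≤ π)
include h0 hπ

lemma arccosKernelOne_cos_eq_cos_add :
    arccosKernelOne (cos θ) = cos θ + (sin θ - θ * cos θ) / π := by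
  rw [arccosKernelOne_cos h0 hπ]
  field_simp
  ring

lemma cos_le_arccosKernelOne_cos : cos θ ≤ arccosKernelOne (cos θ) := by
  rw [arccosKernelOne_cos_eq_cos_add h0 hπ]
  exact le_add_of_nonneg_right (div_nonneg (sub_nonneg.2 (mul_cos_le_sin h0 hπ)) pi_pos.le)

lemma arccosKernelOne_cos_le_one : arccosKernelOne (cos θ) ≤ 1 := by
  rw [arccosKernelOne_cos h0 hπ, div_le_one pi_pos]
  nlinarith [sin_le h0, cos_le_one θ]

lemma cos_angleMap : cos (angleMap θ) = arccosKernelOne (cos θ) :=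
  cos_arccos ((neg_one_le_cos θ).trans (cos_le_arccosKernelOne_cos h0 hπ))
    (arccosKernelOne_cos_le_one h0 hπ)

lemma angleMap_le : angleMap θ ≤ θ :=
  (arccos_le_arccos (cos_le_arccosKernelOne_cos h0 hπ)).trans_eq (arccos_cos h0 hπ)

lemma cos_angleMap_sub_cos_le : cos (angleMap θ) - cos θ ≤ θ ^ 3 / (2 * π) := by
  rw [cos_angleMap h0 hπ, arccosKernelOne_cos_eq_cos_add h0 hπ, add_sub_cancel_left,
    ← div_div (θ ^ 3)]
  gcongr
  nlinarith [sin_le h0, one_sub_sq_div_two_le_cos (x := θ)]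

lemma sub_sq_le_angleMap : θ - θ ^ 2 ≤ angleMap θ := by
  have hg0 : 0 ≤ angleMap θ := arccos_nonneg _
  rcases le_or_gt 1 θ with hθ | hθ
  · nlinarith
  rcases h0.eq_or_lt with rfl | hpos
  · simpa using hg0
  have hgle := angleMap_le h0 hπ
  have hsq := (two_div_pi_sq_mul_le_cos_sub_cos (s := angleMap θ) (t := θ)
    (by rwa [abs_of_nonneg hg0]) (by rw [abs_of_nonneg hg0]; linarith [pi_gt_three])).trans
      (cos_angleMap_sub_cos_le h0 hπ)
  rw [div_mul_eq_mul_div, div_le_div_iff₀ (by positivity) (by positivity)] at hsq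
  have hquad : (4 * π * θ) * (θ - angleMap θ) ≤ (4 * π * θ) * (π / 4 * θ ^ 2) := by
    nlinarith [mul_nonneg (mul_nonneg pi_pos.le hg0) (sub_nonneg.2 hgle)]
  nlinarith [le_of_mul_le_mul_left hquad (by positivity), pi_le_four]

lemma angleMap_iterate_mem_Icc (l : ℕ) : angleMap^[l] θ ∈ Icc 0 θ := by
  induction l with
  | zero => exact ⟨h0, le_rfl⟩
  | succ l ih =>
    rw [Function.iterate_succ_apply']
    exact ⟨arccos_nonneg _, (angleMap_le ih.1 (ih.2.trans hπ)).trans ih.2⟩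

lemma arccosKernelOne_iterate_cos (l : ℕ) :
    arccosKernelOne^[l] (cos θ) = cos (angleMap^[l] θ) := by
  induction l with
  | zero => rfl
  | succ l ih =>
    have hmem := angleMap_iterate_mem_Icc h0 hπ l
    rw [Function.iterate_succ_apply', ih, Function.iterate_succ_apply',
      cos_angleMap hmem.1 (hmem.2.trans hπ)]

lemma sub_mul_sq_le_angleMap_iterate (l : ℕ) : θ - l * θ ^ 2 ≤ angleMap^[l] θ := by
  induction l with
  | zero => simp
  | succ l ih =>
    obtain ⟨hnonneg, hle⟩ := angleMap_iterate_mem_Icc h0 hπ l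
    rw [Function.iterate_succ_apply']
    push_cast
    nlinarith [sub_sq_le_angleMap hnonneg (hle.trans hπ), pow_le_pow_left₀ hnonneg hle 2]

lemma reluKernel_succ (L : ℕ) : reluKernel (L + 1) θ =
    cos (angleMap^[L + 1] θ) + reluKernel L θ * (1 - angleMap^[L] θ / π) := by
  obtain ⟨hnonneg, hle⟩ := angleMap_iterate_mem_Icc h0 hπ L
  rw [reluKernel, tangentKernel, arccosKernelOne_iterate_cos h0 hπ,
    arccosKernelOne_iterate_cos h0 hπ, arccosKernelZero_cos hnonneg (hle.trans hπ), reluKernel]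

end AngleMap

section KernelBounds

lemma reluKernel_zero (θ : ℝ) : reluKernel 0 θ = cos θ := rfl

variable {θ : ℝ} (h0 : 0 ≤ θ)

section Acute

variable (hacute : θ ≤ π / 2) (L : ℕ)
include h0 hacute

lemma reluKernel_nonneg : 0 ≤ reluKernel L θ := by
  have hπ : θ ≤ π := by linarith [pi_pos]
  induction L with
  | zero => exact cos_nonneg_of_mem_Icc ⟨by linarith [pi_pos], hacute⟩
  | succ L ih =>
    have hout := angleMap_iterate_mem_Icc h0 hπ (L + 1)
    have hin := angleMap_iterate_mem_Icc h0 hπ L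
    rw [reluKernel_succ h0 hπ]
    refine add_nonneg (cos_nonneg_of_mem_Icc ⟨?_, hout.2.trans hacute⟩)
      (mul_nonneg ih (sub_nonneg.2 ((div_le_one pi_pos).2 (hin.2.trans hπ))))
    linarith [hout.1, pi_pos]

lemma reluKernel_le_add_one : reluKernel L θ ≤ L + 1 := by
  have hπ : θ ≤ π := by linarith [pi_pos]
  induction L with
  | zero => simpa [reluKernel_zero] using cos_le_one θ
  | succ L ih =>
    have hdamp := mul_nonneg (reluKernel_nonneg h0 hacute L)
      (div_nonneg (angleMap_iterate_mem_Icc h0 hπ L).1 pi_pos.le)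
    rw [reluKernel_succ h0 hπ, mul_one_sub]
    push_cast
    linarith [cos_le_one (angleMap^[L + 1] θ)]

/- The angle between the embeddings never exceeds `θ`, so every layer damps the kernel by a factor
of at least `1 - θ / π` and adds at least `cos θ`. -/
lemma cos_mul_le_reluKernel :
    cos θ * ((L + 1) * (1 - L * θ / (2 * π))) ≤ reluKernel L θ := by
  have hπ : θ ≤ π := by linarith [pi_pos]
  have hcos : 0 ≤ cos θ := cos_nonneg_of_mem_Icc ⟨by linarith [pi_pos], hacute⟩
  induction L with
  | zero => simp [reluKernel_zero]
  | succ L ih =>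
    have hinle := (angleMap_iterate_mem_Icc h0 hπ L).2
    obtain ⟨hout, houtle⟩ := angleMap_iterate_mem_Icc h0 hπ (L + 1)
    have hθ : 0 ≤ 1 - θ / π := sub_nonneg.2 ((div_le_one pi_pos).2 hπ)
    have hslack : 0 ≤ cos θ * ((L + 1) * L * (θ / π) ^ 2 / 2) := by positivity
    calc cos θ * (((L + 1 : ℕ) + 1) * (1 - (L + 1 : ℕ) * θ / (2 * π)))
        = cos θ + cos θ * ((L + 1) * (1 - L * θ / (2 * π))) * (1 - θ / π) -
            cos θ * ((L + 1) * L * (θ / π) ^ 2 / 2) := by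
          push_cast
          field_simp
          ring
      _ ≤ cos θ + cos θ * ((L + 1) * (1 - L * θ / (2 * π))) * (1 - θ / π) := by linarith
      _ ≤ cos (angleMap^[L + 1] θ) + reluKernel L θ * (1 - angleMap^[L] θ / π) := by
          have := reluKernel_nonneg h0 hacute L
          gcongr
          exact cos_le_cos_of_nonneg_of_le_pi hout hπ houtle
      _ = reluKernel (L + 1) θ := (reluKernel_succ h0 hπ L).symm

end Acute

include h0

lemma mul_one_sub_le_reluKernel {L : ℕ} (hL : L * θ ≤ 1) (hacute : θ ≤ π / 2) :
    (L + 1) * (1 - θ ^ 2 / 2 - L * θ / (2 * π)) ≤ reluKernel L θ := by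
  have hdiv : 0 ≤ L * θ / (2 * π) := by positivity
  have hdiv_le : L * θ / (2 * π) ≤ 1 := by
    rw [div_le_one (by positivity)]
    linarith [pi_gt_three]
  refine le_trans ?_ (cos_mul_le_reluKernel h0 hacute L)
  rw [mul_left_comm]
  gcongr
  nlinarith [one_sub_sq_div_two_le_cos (x := θ), mul_nonneg (sq_nonneg θ) hdiv]

lemma mul_one_sub_le_angleMap_iterate (hπ : θ ≤ π) (L : ℕ) :
    θ * (1 - (L + 1) * θ) ≤ angleMap^[L] θ := by
  nlinarith [sub_mul_sq_le_angleMap_iterate h0 hπ L]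

lemma le_reluKernel_mul_angleMap_iterate {L : ℕ} (hL : (L + 1) * θ ≤ 1) :
    (L + 1) * θ * (1 - 2 * ((L + 1) * θ)) ≤ reluKernel L θ * angleMap^[L] θ := by
  have hπ := pi_gt_three
  have hLθ : 0 ≤ L * θ := by positivity
  have hdiv : L * θ / (2 * π) ≤ L * θ := div_le_self hLθ (by linarith)
  have hkernel : (L + 1) * (1 - (L + 1) * θ) ≤ reluKernel L θ := by
    refine le_trans ?_ (mul_one_sub_le_reluKernel h0 (L := L) (by linarith) (by linarith))
    refine mul_le_mul_of_nonneg_left ?_ (by positivity)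
    nlinarith
  have hangle := mul_one_sub_le_angleMap_iterate h0 (by linarith) L
  calc (L + 1) * θ * (1 - 2 * ((L + 1) * θ))
      ≤ (L + 1) * θ * (1 - (L + 1) * θ) ^ 2 := by
        gcongr
        nlinarith [sq_nonneg ((L + 1) * θ)]
    _ = (L + 1) * (1 - (L + 1) * θ) * (θ * (1 - (L + 1) * θ)) := by ring
    _ ≤ reluKernel L θ * angleMap^[L] θ :=
        mul_le_mul hkernel hangle (mul_nonneg h0 (by linarith))
          (reluKernel_nonneg h0 (by linarith) L)

lemma reluKernel_le {L : ℕ} (hL : L * θ ≤ 1) :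
    reluKernel L θ ≤ (L + 1) * (1 - L * θ / (2 * π)) + L ^ 3 * θ ^ 2 := by
  induction L with
  | zero => simpa [reluKernel_zero] using cos_le_one θ
  | succ L ih =>
    push_cast at hL ⊢
    have hLθ : 0 ≤ L * θ := by positivity
    have hπ := pi_gt_three
    have hprod : ((L + 1) * θ / π - ((L + 1) * θ) ^ 2) ≤ reluKernel L θ * (angleMap^[L] θ / π) := by
      rw [mul_div_assoc', le_div_iff₀ pi_pos, sub_mul, div_mul_cancel₀ _ pi_ne_zero]
      nlinarith [le_reluKernel_mul_angleMap_iterate h0 hL, sq_nonneg ((L + 1) * θ)]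
    have hstep : reluKernel (L + 1) θ ≤
        1 + reluKernel L θ - ((L + 1) * θ / π - ((L + 1) * θ) ^ 2) := by
      rw [reluKernel_succ h0 (by linarith)]
      linarith [cos_le_one (angleMap^[L + 1] θ)]
    have hmain : ((L : ℝ) + 1 + 1) * (1 - (L + 1) * θ / (2 * π)) =
        1 + (L + 1) * (1 - L * θ / (2 * π)) - (L + 1) * θ / π := by
      field_simp
      ring
    have hcube : (L : ℝ) ^ 3 * θ ^ 2 + ((L + 1) * θ) ^ 2 ≤ (L + 1) ^ 3 * θ ^ 2 := by
      have : 0 ≤ θ ^ 2 * (2 * L ^ 2 + L) := by positivity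
      nlinarith
    linarith [ih (by linarith)]

end KernelBounds

section Remainder

/-- The remainder of the first-order expansion of the normalized ReLU kernel
`reluKernel L θ / (L + 1)`, relative to `cos θ`; it is meaningful for `θ < π / 2`. -/
def remainder (L : ℕ) (θ : ℝ) : ℝ := reluKernel L θ / (L + 1) / cos θ - 1 + L / (2 * π) * θ

variable {L : ℕ} {θ : ℝ}

lemma reluKernel_div_mem_Icc (h0 : 0 ≤ θ) (hacute : θ ≤ π / 2) :
    reluKernel L θ / (L + 1) ∈ Icc 0 1 :=
  ⟨div_nonneg (reluKernel_nonneg h0 hacute L) (by positivity),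
    div_le_one_of_le₀ (reluKernel_le_add_one h0 hacute L) (by positivity)⟩

lemma cos_reluAngle (h0 : 0 ≤ θ) (hacute : θ ≤ π / 2) :
    cos (reluAngle L θ) = reluKernel L θ / (L + 1) :=
  have hmem := reluKernel_div_mem_Icc h0 hacute
  cos_arccos (neg_one_lt_zero.le.trans hmem.1) hmem.2

lemma cos_reluAngle_eq_remainder (h0 : 0 ≤ θ) (hacute : θ < π / 2) :
    cos (reluAngle L θ) = (1 - L / (2 * π) * θ + remainder L θ) * cos θ := by
  have hcos : cos θ ≠ 0 := (cos_pos_of_mem_Ioo ⟨by linarith [pi_pos], hacute⟩).ne'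
  rw [cos_reluAngle h0 hacute.le, remainder, sub_add_add_cancel, add_sub_cancel,
    div_mul_cancel₀ _ hcos]

lemma remainder_nonneg (h0 : 0 ≤ θ) (hacute : θ < π / 2) : 0 ≤ remainder L θ := by
  have hcos : 0 < cos θ := cos_pos_of_mem_Ioo ⟨by linarith [pi_pos], hacute⟩
  have hkernel : 1 - L * θ / (2 * π) ≤ reluKernel L θ / (L + 1) / cos θ := by
    rw [le_div_iff₀ hcos, le_div_iff₀ (by positivity)]
    linarith [cos_mul_le_reluKernel h0 hacute.le L]
  rw [remainder, div_mul_eq_mul_div]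
  linarith

lemma reluKernel_div_le (h0 : 0 ≤ θ) (hL : L * θ ≤ 1) :
    reluKernel L θ / (L + 1) ≤ 1 - L * θ / (2 * π) + (L * θ) ^ 2 := by
  have hcube : (L : ℝ) ^ 3 * θ ^ 2 ≤ (L * θ) ^ 2 * (L + 1) := by
    linarith [sq_nonneg (L * θ)]
  rw [div_le_iff₀ (by positivity)]
  linarith [reluKernel_le h0 hL]

lemma remainder_le (hL1 : 1 ≤ L) (h0 : 0 ≤ θ) (hL : L * θ ≤ 1) :
    remainder L θ ≤ 3 * (L * θ) ^ 2 := by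
  have hθ : θ ≤ L * θ := le_mul_of_one_le_left h0 (by exact_mod_cast hL1)
  have hcos_pos : 0 < cos θ :=
    cos_pos_of_mem_Ioo ⟨by linarith [pi_pos], by linarith [pi_gt_three]⟩
  have hkernel := reluKernel_div_le h0 hL
  rw [remainder, div_mul_eq_mul_div]
  generalize (L * θ : ℝ) = y at *
  have hslope : 0 ≤ y / (2 * π) := div_nonneg (h0.trans hθ) (by positivity)
  have hslope_le : y / (2 * π) ≤ 1 := by
    rw [div_le_one (by positivity)]
    linarith [pi_gt_three]
  have hsq : y ^ 2 ≤ 1 := pow_le_one₀ (h0.trans hθ) hL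
  have hcos : 1 - y ^ 2 / 2 ≤ cos θ := by
    linarith [one_sub_sq_div_two_le_cos (x := θ), pow_le_pow_left₀ h0 hθ 2]
  have hratio : reluKernel L θ / (L + 1) / cos θ ≤ 1 - y / (2 * π) + 3 * y ^ 2 := by
    rw [div_le_iff₀ hcos_pos]
    calc reluKernel L θ / (L + 1) ≤ 1 - y / (2 * π) + y ^ 2 := hkernel
      _ ≤ (1 - y / (2 * π) + 3 * y ^ 2) * (1 - y ^ 2 / 2) := by
        nlinarith [sq_nonneg y, mul_nonneg hslope (sq_nonneg y)]
      _ ≤ (1 - y / (2 * π) + 3 * y ^ 2) * cos θ :=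
        mul_le_mul_of_nonneg_left hcos (by linarith [sq_nonneg y])
  linarith

theorem abs_remainder_le_mul {ε : ℝ} (hε : 0 < ε) : ∃ δ : ℝ, 0 < δ ∧
    ∀ (L : ℕ) (θ : ℝ), 1 ≤ L → 0 ≤ θ → L * θ < δ → |remainder L θ| ≤ ε * (L * θ) := by
  refine ⟨min 1 (ε / 3), by positivity, fun L θ hL h0 h => ?_⟩
  obtain ⟨hone, hthird⟩ := lt_min_iff.1 h
  have hacute : θ < π / 2 := by
    linarith [le_mul_of_one_le_left h0 (Nat.one_le_cast (α := ℝ).2 hL), pi_gt_three]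
  rw [abs_of_nonneg (remainder_nonneg h0 hacute)]
  calc remainder L θ ≤ 3 * (L * θ) * (L * θ) := by
        linarith [remainder_le hL h0 hone.le]
    _ ≤ ε * (L * θ) := by
        gcongr
        linarith

theorem remainder_isLittleO (hL : 1 ≤ L) : remainder L =o[𝓝[≥] (0 : ℝ)] (fun θ : ℝ => θ) := by
  have hLpos : (0 : ℝ) < L := by exact_mod_cast hL
  rw [isLittleO_iff]
  intro ε hε
  obtain ⟨δ, hδ, hbound⟩ := abs_remainder_le_mul (div_pos hε hLpos)
  filter_upwards [nhdsWithin_le_nhds (gt_mem_nhds (div_pos hδ hLpos)), self_mem_nhdsWithin]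
    with θ hθ h0
  rw [norm_eq_abs, norm_of_nonneg h0]
  refine (hbound L θ hL h0 ((lt_div_iff₀' hLpos).1 hθ)).trans_eq ?_
  rw [← mul_assoc, div_mul_cancel₀ _ hLpos.ne']

end Remainder

section Monotonicity

variable {θ : ℝ}

lemma reluAngle_zero (h0 : 0 ≤ θ) (hπ : θ ≤ π) : reluAngle 0 θ = θ := by
  rw [reluAngle, reluKernel_zero, Nat.cast_zero, zero_add, div_one, arccos_cos h0 hπ]

/- By `reluKernel_succ`, the kernel grows more slowly than `L + 2` as soon as
`L + 1 < reluKernel L θ * (1 + (L + 1) * t / π)`, where `t` is the angle between the embeddings in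
layer `L`. Here `t ≈ θ` and, with `u = (L + 1) * θ / π`, the two factors are at least
`(L + 1) * (1 - 0.52 * u)` and `1 + 0.99 * u`. -/
lemma reluKernel_succ_div_lt {L : ℕ} (h0 : 0 < θ) (hL : (L + 1) * θ < 1 / 100) :
    reluKernel (L + 1) θ / ((L + 1 : ℕ) + 1) < reluKernel L θ / (L + 1) := by
  have hLθ : 0 ≤ L * θ := by positivity
  have hπ := pi_gt_three
  have hπ4 := pi_le_four
  have hkernel := mul_one_sub_le_reluKernel h0.le (L := L) (by linarith) (by linarith)
  have hangle := mul_one_sub_le_angleMap_iterate h0.le (by linarith) L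
  have hnonneg := reluKernel_nonneg h0.le (by linarith) L
  rw [div_lt_div_iff₀ (by positivity) (by positivity), reluKernel_succ h0.le (by linarith)]
  have hcos := cos_le_one (angleMap^[L + 1] θ)
  set t := angleMap^[L] θ
  obtain ⟨u, hu⟩ : ∃ u, (L + 1) * θ = u * π := ⟨(L + 1) * θ / π, by field_simp⟩
  have hu0 : 0 < u := pos_of_mul_pos_left (hu ▸ by positivity) pi_pos.le
  have hu_small : u < 1 / 300 := by nlinarith
  have hkernel_lower : (L + 1) * (1 - 0.52 * u) ≤ reluKernel L θ := by
    refine le_trans (mul_le_mul_of_nonneg_left ?_ (by positivity)) hkernel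
    have hslope : L * θ / (2 * π) ≤ u / 2 := by
      rw [div_le_iff₀ (by positivity)]
      linarith
    nlinarith
  have hangle_lower : 0.99 * u ≤ (L + 1) * t / π := by
    rw [le_div_iff₀ pi_pos]
    nlinarith
  have hgrowth : (L + 1 : ℝ) < reluKernel L θ * (1 + (L + 1) * t / π) := by
    calc (L + 1 : ℝ) < (L + 1) * ((1 - 0.52 * u) * (1 + 0.99 * u)) :=
          lt_mul_of_one_lt_right (by positivity) (by nlinarith)
      _ = (L + 1) * (1 - 0.52 * u) * (1 + 0.99 * u) := by ring
      _ ≤ reluKernel L θ * (1 + (L + 1) * t / π) := by gcongr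
  calc (cos (angleMap^[L + 1] θ) + reluKernel L θ * (1 - t / π)) * (L + 1)
      ≤ (1 + reluKernel L θ * (1 - t / π)) * (L + 1) := by gcongr
    _ = L + 1 + reluKernel L θ * (L + 2) - reluKernel L θ * (1 + (L + 1) * t / π) := by ring
    _ < reluKernel L θ * ((L + 1 : ℕ) + 1) := by
        push_cast
        linarith

theorem reluAngle_lt_reluAngle {L₁ L₂ : ℕ} (h : L₁ < L₂) (h0 : 0 < θ)
    (hL : L₂ * θ < 1 / 100) : reluAngle L₁ θ < reluAngle L₂ θ := by
  have hstep {L : ℕ} (hL : ((L + 1 : ℕ) : ℝ) * θ < 1 / 100) :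
      reluAngle L θ < reluAngle (L + 1) θ := by
    push_cast at hL
    have hacute : θ ≤ π / 2 := by
      linarith [pi_gt_three, mul_nonneg (Nat.cast_nonneg (α := ℝ) L) h0.le]
    exact arccos_lt_arccos
      (neg_one_lt_zero.le.trans (reluKernel_div_mem_Icc h0.le hacute).1)
      (reluKernel_succ_div_lt h0 hL) (reluKernel_div_mem_Icc h0.le hacute).2
  induction L₂, h using Nat.le_induction with
  | base => exact hstep hL
  | succ L _ ih =>
    refine (ih (lt_of_le_of_lt ?_ hL)).trans (hstep hL)
    gcongr
    exact L.le_succ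

theorem lt_reluAngle {L : ℕ} (hL1 : 1 ≤ L) (h0 : 0 < θ) (hL : L * θ < 1 / 100) :
    θ < reluAngle L θ := by
  have hθ : θ ≤ L * θ := le_mul_of_one_le_left h0.le (by exact_mod_cast hL1)
  calc θ = reluAngle 0 θ := (reluAngle_zero h0.le (by linarith [pi_gt_three])).symm
    _ < reluAngle L θ := reluAngle_lt_reluAngle hL1 h0 hL

end Monotonicity

end WideNet

end

theorem mainTheorem1 :
    ∃ (φ : (L d : ℕ) → EuclideanSpace ℝ (Fin d) → EuclideanSpace ℝ (Fin d) → ℝ)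
      (r : ℕ → ℝ → ℝ),
      -- `φ L d x z` is the model gradient angle of the infinitely wide ReLU network
      (∀ (L d : ℕ) (x z : EuclideanSpace ℝ (Fin d)), 1 ≤ L → x ≠ 0 → z ≠ 0 →
        φ L d x z ∈ Icc 0 π ∧ WideNet.IsReLUAngle L x z (φ L d x z)) ∧
      -- the expansion, with remainder `r L θ`
      (∀ (L d : ℕ) (x z : EuclideanSpace ℝ (Fin d)), 1 ≤ L → x ≠ 0 → z ≠ 0 →
        angle x z < π / 2 →
        cos (φ L d x z) =
          (1 - (L : ℝ) / (2 * π) * angle x z + r L (angle x z)) * cos (angle x z)) ∧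
      -- for each depth, the remainder is `o(θ)`
      (∀ L : ℕ, 1 ≤ L → (r L) =o[𝓝[≥] (0 : ℝ)] (fun θ : ℝ => θ)) ∧
      -- uniformly in the depth, in the regime `θ = o(1 / L)`, the remainder is `o(L θ)`
      (∀ ε : ℝ, 0 < ε → ∃ δ : ℝ, 0 < δ ∧ ∀ (L : ℕ) (θ : ℝ), 1 ≤ L → 0 ≤ θ → (L : ℝ) * θ < δ →
        |r L θ| ≤ ε * ((L : ℝ) * θ)) ∧
      -- the linear network keeps the input angle
      (∀ (L d : ℕ) (x z : EuclideanSpace ℝ (Fin d)), 1 ≤ L → x ≠ 0 → z ≠ 0 →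
        WideNet.IsLinearAngle L x z (angle x z)) ∧
      -- in the regime `θ = o(1 / L)`, `φ` exceeds the input angle and grows with the depth
      (∃ c : ℝ, 0 < c ∧
        (∀ (L d : ℕ) (x z : EuclideanSpace ℝ (Fin d)), 1 ≤ L → x ≠ 0 → z ≠ 0 →
          0 < angle x z → (L : ℝ) * angle x z < c → angle x z < φ L d x z) ∧
        (∀ (L₁ L₂ d : ℕ) (x z : EuclideanSpace ℝ (Fin d)), 1 ≤ L₁ → L₁ < L₂ → x ≠ 0 → z ≠ 0 →
          0 < angle x z → (L₂ : ℝ) * angle x z < c → φ L₁ d x z < φ L₂ d x z)) := by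
  refine ⟨fun L d x z => WideNet.reluAngle L (angle x z), WideNet.remainder, ?_, ?_, ?_, ?_, ?_,
    1 / 100, by norm_num, ?_, ?_⟩
  · intro L d x z _ hx hz
    exact ⟨⟨arccos_nonneg _, arccos_le_pi _⟩, WideNet.isReLUAngle_reluAngle hx hz⟩
  · exact fun L d x z _ _ _ hacute => WideNet.cos_reluAngle_eq_remainder (angle_nonneg x z) hacute
  · exact fun L hL => WideNet.remainder_isLittleO hL
  · exact fun ε hε => WideNet.abs_remainder_le_mul hε
  · exact fun L d x z _ hx hz => WideNet.isLinearAngle_angle hx hz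
  · exact fun L d x z hL _ _ h0 hLθ => WideNet.lt_reluAngle hL h0 hLθ
  · exact fun L₁ L₂ d x z _ h _ _ h0 hLθ => WideNet.reluAngle_lt_reluAngle h h0 hLθ
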